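/- Let $f\in\mathbb R[\theta_1,\dots,\theta_d]$ be hyperbolic with respect to $\tau\in\mathbb R^d$: $f$ is homogeneous of some degree $p$, $f(\tau)\neq 0$, and for every $x\in\mathbb R^d$ the univariate polynomial $t\mapsto f(x+t\tau)$ has $p$ real roots, counted with multiplicity. Normalize the sign so that $f(\tau)>0$, and let $C$, the hyperbolicity cone, be the connected component of $\mathbb R^d\setminus\{f=0\}$ that contains $\tau$. For $\theta\in C$, $\eta\in\mathbb R^d$ and $\alpha>0$ let $f(\theta+i\eta)^{-\alpha}$ denote the branch on $C+i\mathbb R^d$ that is positive on $C$. The Riesz kernel of $f$ with parameter $\alpha$ is $$q_\alpha(\sigma)=(2\pi)^{-d}\int_{\mathbb R^d} f(\theta+i\eta)^{-\alpha}\,e^{\langle\theta+i\eta,\sigma\rangle}\,d\eta\qquad(\theta\in C).$$ For arbitrary $\alpha>0$ this is read as a distribution: for $\varphi\in C_c^\infty(\mathbb R^d)$, $$\langle q_\alpha,\varphi\rangle=(2\pi)^{-d}\int_{\mathbb R^d}\Big(\int_{\mathbb R^d} f(\theta+i\eta)^{-\alpha}\,e^{\langle\theta+i\eta,\sigma\rangle}\varphi(\sigma)\,d\sigma\Big)d\eta,$$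 and it is called nonnegative if $\langle q_\alpha,\varphi\rangle$ is real and $\ge 0$ for all $\varphi\ge 0$ in $C_c^\infty(\mathbb R^d)$. If $f$ is complete (that is, $\overline C\cap(-\overline C)=\{0\}$) and $\alpha>d$, the integral converges absolutely and $q_\alpha$ is a function. Let $\mathcal L\subseteq\mathbb R^d$ be a linear subspace that meets the interior of $C$ at a point $e$, let $b_1,\dots,b_c$ be a basis of $\mathcal L$, and regard the restriction $f|_{\mathcal L}$ as the polynomial $t\mapsto f(t_1b_1+\cdots+t_cb_c)$ on $\mathbb R^c$. Let $\alpha>0$. Then: (i) $f|_{\mathcal L}$ is hyperbolic with respect to the coordinate vector of $e$; let $C_{\mathcal L}\subseteq\mathbb R^c$ denote its hyperbolicity cone, the component containing that vector. (ii) If the Riesz kernel of $f$ with parameter $\alpha$, computed at some $\theta\in C$, is nonnegative as a distribution, then so is the Riesz kernel of $f|_{\mathcal L}$ with the same $\alpha$, computed at any $\rho\in C_{\mathcal L}$. (iii) If $f$ is complete, $\alpha>d$, and the Riesz kernel of $f$, computed at some $\theta\in C$, satisfies $q_\alpha(\sigma)\ge 0$ for all $\sigma\in\mathbb R^d$, then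 for any $\rho\in C_{\mathcal L}$ the integral defining the Riesz kernel of $f|_{\mathcal L}$ converges absolutely for every $\sigma\in\mathbb R^c$, and its value is real and $\ge 0$. -/

import Mathlib

open MeasureTheory

noncomputable section

/-- The univariate polynomial `t ↦ f (x + t τ)`. -/
def linePolynomial {d : ℕ} (f : MvPolynomial (Fin d) ℝ) (τ x : EuclideanSpace ℝ (Fin d)) :
    Polynomial ℝ :=
  MvPolynomial.aeval (fun j => Polynomial.C (x j) + Polynomial.C (τ j) * Polynomial.X) f

/-- `f` is homogeneous of some degree `p`, does not vanish at `τ`, and every line in direction `τ`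
(projectively: every line through `τ`) meets `f = 0` in `p` real points, counting
multiplicities. -/
def IsHyperbolicAt {d : ℕ} (f : MvPolynomial (Fin d) ℝ) (τ : EuclideanSpace ℝ (Fin d)) : Prop :=
  ∃ p : ℕ, f.IsHomogeneous p ∧ MvPolynomial.eval τ f ≠ 0 ∧
    ∀ x : EuclideanSpace ℝ (Fin d), (linePolynomial f τ x).roots.card = p

/-- The hyperbolicity cone: the connected component of `τ` in the complement of `f = 0`. -/
def hyperbolicityCone {d : ℕ} (f : MvPolynomial (Fin d) ℝ) (τ : EuclideanSpace ℝ (Fin d)) :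
    Set (EuclideanSpace ℝ (Fin d)) :=
  connectedComponentIn {θ | MvPolynomial.eval θ f ≠ 0} τ

/-- Completeness: the closed hyperbolicity cone is pointed. -/
def HasPointedCone {d : ℕ} (f : MvPolynomial (Fin d) ℝ) (τ : EuclideanSpace ℝ (Fin d)) : Prop :=
  ∀ v : EuclideanSpace ℝ (Fin d), v ∈ closure (hyperbolicityCone f τ) →
    -v ∈ closure (hyperbolicityCone f τ) → v = 0

/-- The value `f (θ + i η)`. -/
def tubeEval {d : ℕ} (f : MvPolynomial (Fin d) ℝ) (θ η : EuclideanSpace ℝ (Fin d)) : ℂ :=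
  MvPolynomial.aeval (fun j => (θ j : ℂ) + Complex.I * (η j : ℂ)) f

/-- The value at `θ + i η` of the branch of `log f` on the tube `C + i ℝᵈ` that is real on the
cone `C`, where `f` is positive on `C`: the real logarithm at `θ`, continued along the segment from
`θ` to `θ + i η`, on which `f` has no zeros. -/
def tubeLog {d : ℕ} (f : MvPolynomial (Fin d) ℝ) (θ η : EuclideanSpace ℝ (Fin d)) : ℂ :=
  (Real.log (MvPolynomial.eval θ f) : ℂ) +
    ∫ t in (0 : ℝ)..1, logDeriv (fun s : ℝ => tubeEval f θ (s • η)) t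

/-- The power `f (θ + i η) ^ (-α)`, for the branch that is positive on the hyperbolicity cone. -/
def tubeNegPow {d : ℕ} (f : MvPolynomial (Fin d) ℝ) (α : ℝ) (θ η : EuclideanSpace ℝ (Fin d)) : ℂ :=
  Complex.exp (-(α : ℂ) * tubeLog f θ η)

/-- The integrand `f (θ + i η) ^ (-α) * exp ⟨θ + i η, σ⟩` of the Riesz kernel. -/
def rieszIntegrand {d : ℕ} (f : MvPolynomial (Fin d) ℝ) (α : ℝ)
    (θ σ η : EuclideanSpace ℝ (Fin d)) : ℂ :=
  tubeNegPow f α θ η *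
    Complex.exp ((inner ℝ θ σ : ℝ) + Complex.I * (inner ℝ η σ : ℝ))

/-- The Riesz kernel as a function of `σ`,
`(2π)⁻ᵈ ∫ f (θ + i η) ^ (-α) exp ⟨θ + i η, σ⟩ dη`. -/
def rieszKernel {d : ℕ} (f : MvPolynomial (Fin d) ℝ) (α : ℝ)
    (θ σ : EuclideanSpace ℝ (Fin d)) : ℂ :=
  (((2 * Real.pi) ^ d)⁻¹ : ℝ) * ∫ η : EuclideanSpace ℝ (Fin d), rieszIntegrand f α θ σ η

/-- The Riesz kernel as a distribution, evaluated at the test function `φ`: the same formula, with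
the pairing in `σ` carried out first. The inner integral decays rapidly in `η`, so this converges
for every `α > 0`. -/
def rieszDistribution {d : ℕ} (f : MvPolynomial (Fin d) ℝ) (α : ℝ)
    (θ : EuclideanSpace ℝ (Fin d)) (φ : EuclideanSpace ℝ (Fin d) → ℝ) : ℂ :=
  (((2 * Real.pi) ^ d)⁻¹ : ℝ) *
    ∫ η : EuclideanSpace ℝ (Fin d), ∫ σ : EuclideanSpace ℝ (Fin d),
      rieszIntegrand f α θ σ η * (φ σ : ℂ)

/-- The Riesz kernel, as a distribution, is nonnegative: it takes nonnegative real values on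
nonnegative smooth compactly supported functions. -/
def RieszDistributionNonneg {d : ℕ} (f : MvPolynomial (Fin d) ℝ) (α : ℝ)
    (θ : EuclideanSpace ℝ (Fin d)) : Prop :=
  ∀ φ : EuclideanSpace ℝ (Fin d) → ℝ,
    ContDiff ℝ (⊤ : ℕ∞) φ → HasCompactSupport φ → (∀ σ, 0 ≤ φ σ) →
      (rieszDistribution f α θ φ).im = 0 ∧ 0 ≤ (rieszDistribution f α θ φ).re

/-- The Riesz kernel, as a function, takes only nonnegative real values. -/
def RieszKernelNonneg {d : ℕ} (f : MvPolynomial (Fin d) ℝ) (α : ℝ)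
    (θ : EuclideanSpace ℝ (Fin d)) : Prop :=
  ∀ σ : EuclideanSpace ℝ (Fin d), (rieszKernel f α θ σ).im = 0 ∧ 0 ≤ (rieszKernel f α θ σ).re

/-- The restriction of `f` to the subspace `L`, as a polynomial in the coordinates of the basis
`b` of `L`: `t ↦ f (t₁ b₁ + ⋯ + t_c b_c)`. -/
def restrictPolynomial {d c : ℕ} (f : MvPolynomial (Fin d) ℝ)
    {L : Submodule ℝ (EuclideanSpace ℝ (Fin d))} (b : Module.Basis (Fin c) ℝ L) :
    MvPolynomial (Fin c) ℝ :=
  MvPolynomial.aeval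
    (fun j => ∑ i : Fin c,
      MvPolynomial.C ((b i : EuclideanSpace ℝ (Fin d)) j) * MvPolynomial.X i) f

/-- The coordinates of a point of `L` in the basis `b`. -/
def basisCoords {d c : ℕ} {L : Submodule ℝ (EuclideanSpace ℝ (Fin d))}
    (b : Module.Basis (Fin c) ℝ L) (e : L) : EuclideanSpace ℝ (Fin c) :=
  WithLp.toLp 2 (b.equivFun e)

end

noncomputable section

/-! ### Homogeneous polynomials along complex lines -/

section PolynomialLines

variable {d : ℕ} {K : Type*} [Field K] [Algebra ℝ K]

/-! Write g_θ(η) = f(θ + iη)^(-α). Up to the positive factor e^⟨θ,σ⟩ and a rescaling, the Riesz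
kernel computed at θ is the Fourier transform of g_θ, so its nonnegativity says that g_θ is positive
definite. Positive definiteness survives pullback along a linear map, and the function attached to f
restricted to L at ρ is exactly g at the image of ρ, composed with the parametrization of L. Since θ
need not lie in L, what remains is to carry positive definiteness from one point of C to every
other.

This is a contour shift (`gaussianTubeIntegral_eq`): after multiplication by the entire function
exp(a z·z + z·σ), a > 0, the integral over θ + iℝᵈ converges absolutely and does not depend on θ in
C. At the given point these integrals are nonnegative for all a and σ, because the Gaussian has a
positive Fourier transform; at the new point they are, up to positive factors, the Fourier
transforms of g times narrow or wide Gaussians. Letting the Gaussian tend to 1 recovers g there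
(`isPositiveDefiniteLimit_tubeNegPow`).

Positive definiteness is encoded by `IsPositiveDefiniteLimit`, which needs no representing measure:
a bounded pointwise limit of inverse transforms of nonnegative integrable functions can be paired
and pulled back by Fubini and dominated convergence. Both hypotheses, on distributions and on
functions, lead into it, and both conclusions are read off from it.

Underneath lies Gårding's theory. `IsHyperbolicAt.stableAt_of_mem` propagates hyperbolicity over the
cone, and its quantitative form |f(θ + iη)| ≥ f(θ) gives a zero-free tube, hence the logarithm, and
the boundedness of g_θ. When the cone is pointed, `integrable_tubeNegPow` adds at least linear
growth of |f(θ + iη)| in ‖η‖, which suffices for integrability when α > d. -/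

theorem Polynomial.natDegree_le_and_coeff_prod {ι R : Type*} [CommSemiring R] (s : Finset ι)
    (g : ι → Polynomial R) (n : ι → ℕ) (h : ∀ i ∈ s, (g i).natDegree ≤ n i) :
    (∏ i ∈ s, g i).natDegree ≤ ∑ i ∈ s, n i ∧
      (∏ i ∈ s, g i).coeff (∑ i ∈ s, n i) = ∏ i ∈ s, (g i).coeff (n i) := by
  classical
  induction s using Finset.induction_on with
  | empty => simp
  | insert a s ha ih =>
    obtain ⟨h1, h2⟩ := ih fun i hi => h i (Finset.mem_insert_of_mem hi)
    have h3 := h a (Finset.mem_insert_self a s)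
    rw [Finset.prod_insert ha, Finset.sum_insert ha, Finset.prod_insert ha]
    exact ⟨Polynomial.natDegree_mul_le_of_le h3 h1,
      by rw [Polynomial.coeff_mul_add_eq_of_natDegree_le h3 h1, h2]⟩

/-- The polynomial `t ↦ f (a + t b)` over an extension of the reals. -/
def lineOver (f : MvPolynomial (Fin d) ℝ) (a b : Fin d → K) : Polynomial K :=
  MvPolynomial.aeval (fun j => Polynomial.C (a j) + Polynomial.C (b j) * Polynomial.X) f

theorem lineOver_eval (f : MvPolynomial (Fin d) ℝ) (a b : Fin d → K) (t : K) :
    (lineOver f a b).eval t = MvPolynomial.aeval (fun j => a j + t * b j) f := by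
  have h := MvPolynomial.comp_aeval_apply
    (fun j => Polynomial.C (a j) + Polynomial.C (b j) * Polynomial.X)
    ((Polynomial.aeval t).restrictScalars ℝ : Polynomial K →ₐ[ℝ] K) f
  simp only [AlgHom.restrictScalars_apply, Polynomial.coe_aeval_eq_eval] at h
  rw [lineOver, h]
  congr 2
  funext j
  rw [Polynomial.eval_add, Polynomial.eval_mul, Polynomial.eval_C, Polynomial.eval_C,
    Polynomial.eval_X, mul_comm]

theorem MvPolynomial.IsHomogeneous.lineOver_natDegree_le_and_coeff {f : MvPolynomial (Fin d) ℝ}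
    {p : ℕ} (hf : f.IsHomogeneous p) (a b : Fin d → K) :
    (lineOver f a b).natDegree ≤ p ∧ (lineOver f a b).coeff p = MvPolynomial.aeval b f := by
  have key : ∀ m ∈ f.support,
      (∏ j, (Polynomial.C (a j) + Polynomial.C (b j) * Polynomial.X) ^ m j).natDegree ≤ p ∧
      (∏ j, (Polynomial.C (a j) + Polynomial.C (b j) * Polynomial.X) ^ m j).coeff p
        = ∏ j, b j ^ m j := by
    intro m hm
    have hp : ∑ j, m j = p := by
      have := hf (MvPolynomial.mem_support_iff.1 hm)
      rw [Finsupp.weight_apply, Finsupp.sum_fintype _ _ (by simp)] at this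
      simpa using this
    have h1 : ∀ j, (Polynomial.C (a j) + Polynomial.C (b j) * Polynomial.X).natDegree ≤ 1 := by
      intro j; rw [add_comm]; exact Polynomial.natDegree_linear_le
    have := Polynomial.natDegree_le_and_coeff_prod Finset.univ
      (fun j => (Polynomial.C (a j) + Polynomial.C (b j) * Polynomial.X) ^ m j) (fun j => m j)
      (fun j _ => by simpa using Polynomial.natDegree_pow_le_of_le (m j) (h1 j))
    rw [hp] at this
    refine ⟨this.1, this.2.trans (Finset.prod_congr rfl fun j _ => ?_)⟩
    have := Polynomial.coeff_pow_of_natDegree_le (m := m j) (h1 j)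
    simpa using this
  rw [lineOver, MvPolynomial.aeval_def, MvPolynomial.eval₂_eq', MvPolynomial.aeval_def,
    MvPolynomial.eval₂_eq']
  constructor
  · refine Polynomial.natDegree_sum_le_of_forall_le _ _ fun m hm => ?_
    rw [IsScalarTower.algebraMap_apply ℝ K (Polynomial K), Polynomial.algebraMap_eq]
    exact (Polynomial.natDegree_C_mul_le _ _).trans (key m hm).1
  · rw [Polynomial.finsetSum_coeff]
    refine Finset.sum_congr rfl fun m hm => ?_
    rw [IsScalarTower.algebraMap_apply ℝ K (Polynomial K), Polynomial.algebraMap_eq,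
      Polynomial.coeff_C_mul, (key m hm).2]

theorem MvPolynomial.IsHomogeneous.aeval_mul {f : MvPolynomial (Fin d) ℝ} {p : ℕ}
    (hf : f.IsHomogeneous p) (c : K) (z : Fin d → K) :
    MvPolynomial.aeval (fun j => c * z j) f = c ^ p * MvPolynomial.aeval z f := by
  simp only [MvPolynomial.aeval_def, MvPolynomial.eval₂_eq', Finset.mul_sum]
  refine Finset.sum_congr rfl fun m hm => ?_
  have hp : ∑ j, m j = p := by
    have := hf (MvPolynomial.mem_support_iff.1 hm)
    rw [Finsupp.weight_apply, Finsupp.sum_fintype _ _ (by simp)] at this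
    simpa using this
  simp only [mul_pow, Finset.prod_mul_distrib, Finset.prod_pow_eq_pow_sum, hp]
  ring

theorem continuous_aeval_complex (f : MvPolynomial (Fin d) ℝ) :
    Continuous fun z : Fin d → ℂ => MvPolynomial.aeval z f := by
  simp only [MvPolynomial.aeval_def, MvPolynomial.eval₂_eq']
  fun_prop

theorem aeval_ofReal (f : MvPolynomial (Fin d) ℝ) (x : Fin d → ℝ) :
    MvPolynomial.aeval (fun j => (x j : ℂ)) f = (MvPolynomial.eval x f : ℂ) := by
  have := MvPolynomial.aeval_algebraMap_apply (R := ℝ) (A := ℝ) ℂ x f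
  simpa [Function.comp_def] using this

/-- Lower bound for a polynomial all of whose roots lie in the closed lower half-plane. -/
theorem Polynomial.norm_coeff_mul_im_pow_le {P : Polynomial ℂ} {p : ℕ} (hP : P.natDegree ≤ p)
    (hroot : ∀ t : ℂ, 0 < t.im → P.eval t ≠ 0) {t : ℂ} (ht : 0 ≤ t.im) :
    ‖P.coeff p‖ * t.im ^ p ≤ ‖P.eval t‖ := by
  rcases eq_or_ne (P.coeff p) 0 with h0 | h0
  · simp [h0]
  have hdeg : P.natDegree = p := le_antisymm hP (Polynomial.le_natDegree_of_ne_zero h0)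
  have hs := IsAlgClosed.splits P
  have hcard : P.roots.card = p := by rw [← hdeg, hs.natDegree_eq_card_roots]
  have hP0 : P ≠ 0 := by rintro rfl; simp at h0
  -- Over ℂ the polynomial splits, and each factor satisfies |t - r| ≥ Im t - Im r ≥ Im t because
  -- every root has Im r ≤ 0.
  rw [hs.eval_eq_prod_roots t, norm_mul, Polynomial.leadingCoeff, hdeg]
  refine mul_le_mul_of_nonneg_left ?_ (norm_nonneg _)
  have hr : ∀ r ∈ P.roots, t.im ≤ ‖t - r‖ := by
    intro r hr
    have h1 : r.im ≤ 0 := by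
      by_contra h
      exact hroot r (not_le.1 h) ((Polynomial.mem_roots hP0).1 hr)
    have h2 := Complex.abs_im_le_norm (t - r)
    rw [Complex.sub_im] at h2
    linarith [le_abs_self (t.im - r.im)]
  rw [← hcard]
  clear hcard
  revert hr
  generalize P.roots = r
  induction r using Multiset.induction_on with
  | empty => simp
  | cons a s ih =>
    intro hr
    rw [Multiset.card_cons, Multiset.map_cons, Multiset.prod_cons, norm_mul, pow_succ']
    exact mul_le_mul (hr a (Multiset.mem_cons_self a s))
      (ih fun r hr' => hr r (Multiset.mem_cons_of_mem hr')) (by positivity) (norm_nonneg _)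

end PolynomialLines

/-! ### Hyperbolicity as absence of zeros with a given imaginary direction -/

section Garding

variable {d : ℕ}

/-- `f` has no zeros over the points of the tube with imaginary part `x`. -/
def StableAt (f : MvPolynomial (Fin d) ℝ) (x : EuclideanSpace ℝ (Fin d)) : Prop :=
  ∀ y : EuclideanSpace ℝ (Fin d),
    MvPolynomial.aeval (fun j => (y j : ℂ) + Complex.I * (x j : ℂ)) f ≠ 0

/-- By homogeneity, dividing by Im t reduces a general non-real t to t = i plus a real translation.
-/
theorem StableAt.aeval_ne_zero {f : MvPolynomial (Fin d) ℝ} {p : ℕ} (hf : f.IsHomogeneous p)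
    {x : EuclideanSpace ℝ (Fin d)} (hx : StableAt f x) (y : EuclideanSpace ℝ (Fin d)) {t : ℂ}
    (ht : t.im ≠ 0) : MvPolynomial.aeval (fun j => (y j : ℂ) + t * (x j : ℂ)) f ≠ 0 := by
  have h := hx (t.im⁻¹ • (y + t.re • x))
  have h2 : (fun j => (y j : ℂ) + t * (x j : ℂ)) =
      fun j => (t.im : ℂ) *
        (((t.im⁻¹ • (y + t.re • x)) j : ℝ) + Complex.I * (x j : ℂ)) := by
    funext j
    have : (t.im : ℂ) ≠ 0 := by exact_mod_cast ht
    simp only [PiLp.smul_apply, PiLp.add_apply, smul_eq_mul]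
    push_cast
    field_simp
    conv_lhs => rw [← Complex.re_add_im t]
    ring
  rw [h2, hf.aeval_mul]
  exact mul_ne_zero (pow_ne_zero _ (by exact_mod_cast ht)) h

theorem StableAt.eval_ne_zero {f : MvPolynomial (Fin d) ℝ} {p : ℕ} (hf : f.IsHomogeneous p)
    {x : EuclideanSpace ℝ (Fin d)} (hx : StableAt f x) : MvPolynomial.eval x f ≠ 0 := by
  have h := hx 0
  simp only [PiLp.zero_apply, Complex.ofReal_zero, zero_add] at h
  rw [hf.aeval_mul, aeval_ofReal] at h
  exact_mod_cast (mul_ne_zero_iff.1 h).2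

theorem lineOver_map (f : MvPolynomial (Fin d) ℝ) (a b : Fin d → ℝ) :
    (lineOver f a b).map (algebraMap ℝ ℂ) =
      lineOver f (fun j => (a j : ℂ)) (fun j => (b j : ℂ)) := by
  have h := MvPolynomial.comp_aeval_apply
    (fun j => Polynomial.C (a j) + Polynomial.C (b j) * Polynomial.X)
    (Polynomial.mapAlg ℝ ℂ) f
  rw [Polynomial.mapAlg_eq_map] at h
  rw [lineOver, h, lineOver]
  congr 2
  funext j
  simp [Polynomial.mapAlg_eq_map]

theorem lineOver_natDegree_eq {f : MvPolynomial (Fin d) ℝ} {p : ℕ} (hf : f.IsHomogeneous p)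
    {a b : Fin d → ℝ} (hb : MvPolynomial.eval b f ≠ 0) : (lineOver f a b).natDegree = p := by
  have h := hf.lineOver_natDegree_le_and_coeff a b
  refine le_antisymm h.1 (Polynomial.le_natDegree_of_ne_zero ?_)
  rw [h.2]
  exact hb

/-- A zero at y + iτ would make i a root of t ↦ f(y + tτ), which has only real roots. -/
theorem IsHyperbolicAt.stableAt {f : MvPolynomial (Fin d) ℝ} {τ : EuclideanSpace ℝ (Fin d)}
    (h : IsHyperbolicAt f τ) : StableAt f τ := by
  obtain ⟨p, hf, hτ, hr⟩ := h
  intro y h0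
  have hdeg := lineOver_natDegree_eq hf (a := y) hτ
  have hs : (lineOver f (y : Fin d → ℝ) τ).Splits :=
    Polynomial.splits_iff_card_roots.2 ((hr y).trans hdeg.symm)
  have hp0 : lineOver f (y : Fin d → ℝ) τ ≠ 0 := by
    intro h
    have h2 := (hf.lineOver_natDegree_le_and_coeff (y : Fin d → ℝ) τ).2
    rw [h, Polynomial.coeff_zero] at h2
    exact hτ h2.symm
  have := hs.mem_range_of_isRoot (i := algebraMap ℝ ℂ) (x := Complex.I) hp0 (by
    rw [lineOver_map, Polynomial.IsRoot, lineOver_eval, h0])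
  obtain ⟨r, hr⟩ := this
  have := congrArg Complex.im hr
  simp at this

theorem StableAt.isHyperbolicAt {f : MvPolynomial (Fin d) ℝ} {p : ℕ} (hf : f.IsHomogeneous p)
    {x : EuclideanSpace ℝ (Fin d)} (hx : StableAt f x) : IsHyperbolicAt f x := by
  have h0 := hx.eval_ne_zero hf
  refine ⟨p, hf, h0, fun y => ?_⟩
  have hdeg := lineOver_natDegree_eq hf (a := y) h0
  have hs : (lineOver f (y : Fin d → ℝ) x).Splits := by
    refine Polynomial.Splits.of_splits_map (algebraMap ℝ ℂ) (IsAlgClosed.splits _) fun t ht => ?_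
    have h1 := (Polynomial.mem_roots'.1 ht).2
    rw [lineOver_map, Polynomial.IsRoot, lineOver_eval] at h1
    have h2 : t.im = 0 := by
      by_contra h
      exact hx.aeval_ne_zero hf y h h1
    exact ⟨t.re, Complex.ext (by simp) (by simp [h2])⟩
  exact (Polynomial.splits_iff_card_roots.1 hs).trans hdeg

/-- Quantitative hyperbolicity. -/
theorem StableAt.le_norm_aeval {f : MvPolynomial (Fin d) ℝ} {p : ℕ} (hf : f.IsHomogeneous p)
    {x : EuclideanSpace ℝ (Fin d)} (hx : StableAt f x) (y : EuclideanSpace ℝ (Fin d)) :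
    |MvPolynomial.eval x f| ≤
      ‖MvPolynomial.aeval (fun j => (y j : ℂ) + Complex.I * (x j : ℂ)) f‖ := by
  have h1 := hf.lineOver_natDegree_le_and_coeff (fun j => (y j : ℂ)) (fun j => (x j : ℂ))
  have := Polynomial.norm_coeff_mul_im_pow_le h1.1 (fun t ht => by
    rw [lineOver_eval]
    exact hx.aeval_ne_zero hf y ht.ne') (t := Complex.I) (by simp)
  rw [h1.2, lineOver_eval, aeval_ofReal] at this
  simpa using this

end Garding

/-! ### Gårding's theorem: propagation over the hyperbolicity cone -/

section GardingHomotopy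

open Filter Topology

variable {d : ℕ}

theorem exists_ball_aeval_ne_zero (f : MvPolynomial (Fin d) ℝ) {z : Fin d → ℂ}
    (hz : MvPolynomial.aeval z f ≠ 0) :
    ∃ δ > 0, ∀ w : Fin d → ℂ, ‖w‖ < δ → MvPolynomial.aeval (z + w) f ≠ 0 := by
  have h := (continuous_aeval_complex f).continuousAt.eventually_ne hz
  obtain ⟨δ, hδ, hb⟩ := Metric.eventually_nhds_iff.1 h
  exact ⟨δ, hδ, fun w hw => hb (by simpa [dist_eq_norm] using hw)⟩

/-- The zeros of `t ↦ f (i x + t x' + l y)` stay in the open lower half-plane as `l` grows. -/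
theorem StableAt.aeval_add_mul_ne_zero {f : MvPolynomial (Fin d) ℝ} {p : ℕ}
    (hf : f.IsHomogeneous p) {x x' : EuclideanSpace ℝ (Fin d)} (hx : StableAt f x)
    (hx' : ∀ t : ℝ, 0 ≤ t → MvPolynomial.eval (x' + t • x) f ≠ 0)
    (y : EuclideanSpace ℝ (Fin d)) {t : ℂ} (ht : 0 ≤ t.im) :
    MvPolynomial.aeval
      (fun j => (Complex.I * (x j : ℂ) + (y j : ℂ)) + t * (x' j : ℂ)) f ≠ 0 := by
  set c : ℝ := |MvPolynomial.eval x' f|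
  have hfx' : MvPolynomial.eval x' f ≠ 0 := by simpa using hx' 0 le_rfl
  let u : ℝ → Fin d → ℂ := fun l j => Complex.I * (x j : ℂ) + l * (y j : ℂ)
  have hu : Continuous u := by fun_prop
  let Q : ℝ → ℂ → ℂ := fun l t => MvPolynomial.aeval (fun j => u l j + t * (x' j : ℂ)) f
  have hQ : Continuous fun a : ℝ × ℂ => Q a.1 a.2 := by
    refine (continuous_aeval_complex f).comp (continuous_pi fun j => ?_)
    have : Continuous fun a : ℝ × ℂ => u a.1 j := (continuous_apply j).comp (hu.comp continuous_fst)
    fun_prop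
  -- Membership in `B` is a closed condition in l, yet it is equivalent to the absence of zeros in
  -- the closed upper half-plane: real t are excluded by stability at x, and the converse is the
  -- root-product bound. This replaces an argument on the continuity of roots.
  let B : Set ℝ := {l | ∀ t : ℂ, 0 ≤ t.im → c * t.im ^ p ≤ ‖Q l t‖}
  have hBclosed : IsClosed B := by
    simp only [B, Set.ofPred_forall]
    refine isClosed_iInter fun t => isClosed_iInter fun _ => ?_
    exact isClosed_le continuous_const
      (hQ.comp (continuous_id.prodMk continuous_const : Continuous fun l : ℝ => (l, t))).norm
  have hreal : ∀ (l : ℝ) (t : ℂ), t.im = 0 → Q l t ≠ 0 := by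
    intro l t ht
    have := hx (l • y + t.re • x')
    convert this using 3 with j
    funext j
    simp only [u, PiLp.smul_apply, PiLp.add_apply, smul_eq_mul]
    rw [show t = (t.re : ℂ) from Complex.ext (by simp) (by simp [ht])]
    push_cast
    simp only [Complex.ofReal_re]
    ring
  have hBne : ∀ l ∈ B, ∀ t : ℂ, 0 ≤ t.im → Q l t ≠ 0 := by
    intro l hl t ht h0
    rcases ht.eq_or_lt with h | h
    · exact hreal l t h.symm h0
    · have h2 := hl t ht
      rw [h0, norm_zero] at h2
      have : 0 < c * t.im ^ p := mul_pos (abs_pos.2 hfx') (pow_pos h p)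
      linarith
  have hneB : ∀ l, (∀ t : ℂ, 0 ≤ t.im → Q l t ≠ 0) → l ∈ B := by
    intro l hl t ht
    have h1 := hf.lineOver_natDegree_le_and_coeff (u l) (fun j => (x' j : ℂ))
    have := Polynomial.norm_coeff_mul_im_pow_le h1.1 (fun t ht => by
      rw [lineOver_eval]
      exact hl t ht.le) ht
    rw [h1.2, lineOver_eval, aeval_ofReal] at this
    simpa [c, Q] using this
  -- At l = 0, f(ix + tx') = t^p f(x' + (i/t)x). If i/t is real, Im t ≥ 0 makes it nonnegative and
  -- the ray hypothesis applies; otherwise stability at x does.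
  have hB0 : (0 : ℝ) ∈ B := by
    refine hneB 0 fun t ht => ?_
    rcases eq_or_ne t 0 with rfl | ht0
    · exact hreal 0 0 rfl
    have h1 : (fun j => u 0 j + t * (x' j : ℂ)) =
        fun j => t * ((x' j : ℂ) + Complex.I / t * (x j : ℂ)) := by
      funext j
      simp only [u]
      field_simp
      push_cast
      ring
    simp only [Q]
    rw [h1, hf.aeval_mul]
    refine mul_ne_zero (pow_ne_zero _ ht0) ?_
    by_cases him : (Complex.I / t).im = 0
    · have hre : 0 ≤ (Complex.I / t).re := by
        rw [Complex.div_re]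
        simp only [Complex.I_re, Complex.I_im, zero_mul, zero_div, one_mul, zero_add]
        exact div_nonneg ht (Complex.normSq_nonneg t)
      have h3 := hx' _ hre
      rw [show Complex.I / t = ((Complex.I / t).re : ℂ) from Complex.ext (by simp) (by simp [him])]
      have h4 : (fun j => (x' j : ℂ) + ((Complex.I / t).re : ℂ) * (x j : ℂ)) =
          fun j => (((x' + (Complex.I / t).re • x) j : ℝ) : ℂ) := by
        funext j; simp
      rw [h4, aeval_ofReal]
      exact_mod_cast h3
    · exact hx.aeval_ne_zero hf x' him
  have hopen : ∀ l ∈ B, ∀ᶠ l' in 𝓝 l, l' ∈ B := by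
    intro l hl
    obtain ⟨δ, hδ, hball⟩ := exists_ball_aeval_ne_zero f
      (z := fun j => (x' j : ℂ)) (by rw [aeval_ofReal]; exact_mod_cast hfx')
    -- Beyond radius `R` the perturbation u/t of x' has norm below δ, so no zero can enter from
    -- infinity; the remaining half-disc is compact.
    set R : ℝ := (‖u l‖ + 1) / δ with hR
    have hRpos : 0 < R := by positivity
    have hev1 : ∀ᶠ l' in 𝓝 l, ‖u l'‖ < ‖u l‖ + 1 :=
      hu.norm.continuousAt.eventually_lt_const (by linarith)
    have hK : IsCompact (Metric.closedBall (0 : ℂ) R ∩ {t | 0 ≤ t.im}) :=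
      (isCompact_closedBall _ _).inter_right (isClosed_le continuous_const Complex.continuous_im)
    have hev2 : ∀ᶠ l' in 𝓝 l, ∀ t ∈ Metric.closedBall (0 : ℂ) R ∩ {t | 0 ≤ t.im},
        Q l' t ≠ 0 := by
      refine hK.eventually_forall_of_forall_eventually fun t ht => ?_
      exact hQ.continuousAt.eventually_ne (hBne l hl t ht.2)
    filter_upwards [hev1, hev2] with l' h1 h2
    refine hneB l' fun t ht => ?_
    rcases le_or_gt ‖t‖ R with h | h
    · exact h2 t ⟨by simpa using h, ht⟩
    have ht0 : t ≠ 0 := norm_pos_iff.1 (hRpos.trans h)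
    have h3 : (fun j => u l' j + t * (x' j : ℂ)) =
        fun j => t * (((fun j => (x' j : ℂ)) + t⁻¹ • u l') j) := by
      funext j
      simp only [Pi.add_apply, Pi.smul_apply, smul_eq_mul]
      field_simp
      ring
    simp only [Q]
    rw [h3, hf.aeval_mul]
    refine mul_ne_zero (pow_ne_zero _ ht0) (hball _ ?_)
    rw [norm_smul, norm_inv, inv_mul_lt_iff₀ (hRpos.trans h)]
    calc ‖u l'‖ < ‖u l‖ + 1 := h1
      _ = R * δ := by rw [hR]; field_simp
      _ ≤ ‖t‖ * δ := by gcongr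
  have h1B : (1 : ℝ) ∈ B := by
    have : Set.Icc (0 : ℝ) 1 ⊆ B :=
      (hBclosed.inter isClosed_Icc).Icc_subset_of_forall_mem_nhdsWithin hB0
        fun l hl => mem_nhdsWithin_of_mem_nhds (hopen l hl.1)
    exact this ⟨zero_le_one, le_rfl⟩
  have := hBne 1 h1B t ht
  simpa [Q, u] using this

/-- The previous result, rescaled by μ, excludes zeros of t ↦ f(y + iμx + tx') in the upper
half-plane. The resulting lower bound |f(x')| is independent of μ, so it persists as μ → 0. -/
theorem StableAt.of_eval_add_smul_ne_zero {f : MvPolynomial (Fin d) ℝ} {p : ℕ}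
    (hf : f.IsHomogeneous p) {x x' : EuclideanSpace ℝ (Fin d)} (hx : StableAt f x)
    (hx' : ∀ t : ℝ, 0 ≤ t → MvPolynomial.eval (x' + t • x) f ≠ 0) : StableAt f x' := by
  intro y h0
  have hfx' : MvPolynomial.eval x' f ≠ 0 := by simpa using hx' 0 le_rfl
  have key : ∀ μ : ℝ, 0 < μ → |MvPolynomial.eval x' f| ≤ ‖MvPolynomial.aeval
      (fun j => ((y j : ℂ) + μ * Complex.I * (x j : ℂ)) + Complex.I * (x' j : ℂ)) f‖ := by
    intro μ hμ
    have h1 := hf.lineOver_natDegree_le_and_coeff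
      (fun j => (y j : ℂ) + μ * Complex.I * (x j : ℂ)) (fun j => (x' j : ℂ))
    have hμ' : (μ : ℂ) ≠ 0 := by exact_mod_cast hμ.ne'
    have := Polynomial.norm_coeff_mul_im_pow_le h1.1 (fun t ht => by
      rw [lineOver_eval]
      have h2 := hx.aeval_add_mul_ne_zero hf hx' (μ⁻¹ • y) (t := t / μ) (by
        rw [Complex.div_ofReal_im]; positivity)
      have h3 : (fun j => ((y j : ℂ) + μ * Complex.I * (x j : ℂ)) + t * (x' j : ℂ)) =
          fun j => (μ : ℂ) * (Complex.I * (x j : ℂ) + ((μ⁻¹ • y) j : ℝ) + t / μ * (x' j : ℂ)) := by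
        funext j
        simp only [PiLp.smul_apply, smul_eq_mul]
        push_cast
        field_simp
        ring
      rw [h3, hf.aeval_mul]
      exact mul_ne_zero (pow_ne_zero _ hμ') h2) (t := Complex.I) (by simp)
    rw [h1.2, lineOver_eval, aeval_ofReal] at this
    simpa using this
  have hc : Continuous fun μ : ℝ => ‖MvPolynomial.aeval
      (fun j => ((y j : ℂ) + μ * Complex.I * (x j : ℂ)) + Complex.I * (x' j : ℂ)) f‖ :=
    ((continuous_aeval_complex f).comp (by fun_prop)).norm
  have hlim := (hc.tendsto 0).mono_left (nhdsWithin_le_nhds (s := Set.Ioi 0))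
  have := ge_of_tendsto hlim (eventually_nhdsWithin_of_forall fun μ hμ => key μ hμ)
  simp only [Complex.ofReal_zero, zero_mul, add_zero] at this
  rw [h0, norm_zero] at this
  exact absurd (abs_pos.2 hfx') (not_lt.2 this)

theorem continuous_eval_euclidean (f : MvPolynomial (Fin d) ℝ) :
    Continuous fun x : EuclideanSpace ℝ (Fin d) => MvPolynomial.eval x f :=
  (MvPolynomial.continuous_eval f).comp (PiLp.continuous_ofLp 2 _)

theorem isOpen_eval_ne_zero (f : MvPolynomial (Fin d) ℝ) :
    IsOpen {x : EuclideanSpace ℝ (Fin d) | MvPolynomial.eval x f ≠ 0} :=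
  isOpen_ne.preimage (continuous_eval_euclidean f)

theorem isOpen_hyperbolicityCone (f : MvPolynomial (Fin d) ℝ) (τ : EuclideanSpace ℝ (Fin d)) :
    IsOpen (hyperbolicityCone f τ) :=
  (isOpen_eval_ne_zero f).connectedComponentIn

theorem eval_ne_zero_of_mem_hyperbolicityCone {f : MvPolynomial (Fin d) ℝ}
    {τ x : EuclideanSpace ℝ (Fin d)} (hx : x ∈ hyperbolicityCone f τ) :
    MvPolynomial.eval x f ≠ 0 :=
  connectedComponentIn_subset _ _ hx

theorem MvPolynomial.IsHomogeneous.eval_smul_euclidean {f : MvPolynomial (Fin d) ℝ} {p : ℕ}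
    (hf : f.IsHomogeneous p) (c : ℝ) (x : EuclideanSpace ℝ (Fin d)) :
    MvPolynomial.eval (c • x) f = c ^ p * MvPolynomial.eval x f :=
  hf.aeval_mul (K := ℝ) c x.ofLp

/-- Gårding: hyperbolicity propagates to the whole hyperbolicity cone. -/
theorem IsHyperbolicAt.stableAt_of_mem {f : MvPolynomial (Fin d) ℝ}
    {τ x : EuclideanSpace ℝ (Fin d)} (h : IsHyperbolicAt f τ) (hx : x ∈ hyperbolicityCone f τ) :
    StableAt f x := by
  obtain ⟨p, hf, hτ, hr⟩ := id h
  have hpre : IsPreconnected (hyperbolicityCone f τ) := isPreconnected_connectedComponentIn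
  -- If z' is in a zero-free ball around z, then z' + tz is 1 + t times a point of that ball, so f
  -- does not vanish on the ray.
  have hopen : IsOpen {z : EuclideanSpace ℝ (Fin d) | StableAt f z} := by
    rw [isOpen_iff_mem_nhds]
    intro z hz
    obtain ⟨r, hr, hball⟩ := Metric.isOpen_iff.1 (isOpen_eval_ne_zero f) z (hz.eval_ne_zero hf)
    filter_upwards [Metric.ball_mem_nhds z hr] with z' hz'
    refine hz.of_eval_add_smul_ne_zero hf fun t ht => ?_
    have hpos : 0 < 1 + t := by linarith
    have hmem : (1 + t)⁻¹ • (z' + t • z) ∈ Metric.ball z r := by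
      have := (convex_ball z r) hz' (Metric.mem_ball_self hr) (a := (1 + t)⁻¹) (b := (1 + t)⁻¹ * t)
        (by positivity) (by positivity) (by field_simp)
      simpa [smul_add, smul_smul] using this
    have h1 := hball hmem
    simp only [Set.mem_ofPred_eq] at h1
    intro h2
    apply h1
    rw [hf.eval_smul_euclidean, h2, mul_zero]
  -- Stability itself is not visibly closed; the quantitative inequality is, and it implies
  -- stability wherever f(z) ≠ 0.
  have hclosed : IsClosed {z : EuclideanSpace ℝ (Fin d) |
      ∀ y : EuclideanSpace ℝ (Fin d), |MvPolynomial.eval z f| ≤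
        ‖MvPolynomial.aeval (fun j => (y j : ℂ) + Complex.I * (z j : ℂ)) f‖} := by
    simp only [Set.ofPred_forall]
    refine isClosed_iInter fun y => isClosed_le (continuous_eval_euclidean f).abs ?_
    exact ((continuous_aeval_complex f).comp (by fun_prop)).norm
  refine hpre.subset_of_closure_inter_subset hopen ⟨τ, mem_connectedComponentIn hτ, h.stableAt⟩
    ?_ hx
  rintro z ⟨hz1, hz2⟩ y h0
  have h1 : z ∈ {z : EuclideanSpace ℝ (Fin d) |
      ∀ y : EuclideanSpace ℝ (Fin d), |MvPolynomial.eval z f| ≤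
        ‖MvPolynomial.aeval (fun j => (y j : ℂ) + Complex.I * (z j : ℂ)) f‖} :=
    closure_minimal (fun w hw y => StableAt.le_norm_aeval hf hw y) hclosed hz1
  have h2 := h1 y
  rw [h0, norm_zero] at h2
  exact absurd (abs_pos.2 (eval_ne_zero_of_mem_hyperbolicityCone hz2)) (not_lt.2 h2)

theorem eval_pos_of_mem_hyperbolicityCone {f : MvPolynomial (Fin d) ℝ}
    {τ x : EuclideanSpace ℝ (Fin d)} (hτ : 0 < MvPolynomial.eval τ f)
    (hx : x ∈ hyperbolicityCone f τ) : 0 < MvPolynomial.eval x f := by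
  by_contra h
  have hpre : IsPreconnected (hyperbolicityCone f τ) := isPreconnected_connectedComponentIn
  obtain ⟨z, hz, hz0⟩ := hpre.intermediate_value hx (mem_connectedComponentIn hτ.ne')
    (continuous_eval_euclidean f).continuousOn ⟨not_lt.1 h, hτ.le⟩
  exact eval_ne_zero_of_mem_hyperbolicityCone hz hz0

theorem hyperbolicityCone_eq_of_mem {f : MvPolynomial (Fin d) ℝ}
    {τ x : EuclideanSpace ℝ (Fin d)} (hx : x ∈ hyperbolicityCone f τ) :
    hyperbolicityCone f x = hyperbolicityCone f τ :=
  (connectedComponentIn_eq hx).symm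

/-- Lower bound of a hyperbolic polynomial on its tube. -/
theorem IsHyperbolicAt.le_norm_tubeEval {f : MvPolynomial (Fin d) ℝ}
    {τ x : EuclideanSpace ℝ (Fin d)} (h : IsHyperbolicAt f τ) (hx : x ∈ hyperbolicityCone f τ)
    (η : EuclideanSpace ℝ (Fin d)) : |MvPolynomial.eval x f| ≤ ‖tubeEval f x η‖ := by
  obtain ⟨p, hf, -, -⟩ := id h
  -- Multiplication by i sends x + iη to -η + ix and, by homogeneity, preserves the modulus of f.
  have h1 := (h.stableAt_of_mem hx).le_norm_aeval hf (-η)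
  have h2 : (fun j => (((-η) j : ℝ) : ℂ) + Complex.I * (x j : ℂ)) =
      fun j => Complex.I * ((x j : ℂ) + Complex.I * (η j : ℂ)) := by
    funext j
    simp only [PiLp.neg_apply, Complex.ofReal_neg, mul_add, ← mul_assoc, Complex.I_mul_I]
    ring
  rw [h2, hf.aeval_mul, norm_mul, norm_pow, Complex.norm_I, one_pow, one_mul] at h1
  exact h1

theorem IsHyperbolicAt.tubeEval_ne_zero {f : MvPolynomial (Fin d) ℝ}
    {τ x : EuclideanSpace ℝ (Fin d)} (h : IsHyperbolicAt f τ) (hx : x ∈ hyperbolicityCone f τ)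
    (η : EuclideanSpace ℝ (Fin d)) : tubeEval f x η ≠ 0 := by
  intro h0
  have := h.le_norm_tubeEval hx η
  rw [h0, norm_zero] at this
  exact absurd (abs_pos.2 (eval_ne_zero_of_mem_hyperbolicityCone hx)) (not_lt.2 this)

end GardingHomotopy

/-! ### The logarithm and powers of f on the tube -/

section TubeLogarithm

open Filter Topology

variable {d : ℕ} {f : MvPolynomial (Fin d) ℝ} {τ θ : EuclideanSpace ℝ (Fin d)}

theorem contDiff_aeval_complex (f : MvPolynomial (Fin d) ℝ) :
    ContDiff ℂ (⊤ : ℕ∞) fun z : Fin d → ℂ => MvPolynomial.aeval z f := by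
  simp only [MvPolynomial.aeval_def, MvPolynomial.eval₂_eq']
  refine ContDiff.sum fun m _ => contDiff_const.mul (contDiff_prod fun j _ => ?_)
  exact (contDiff_apply ℂ ℂ j).pow _

theorem contDiff_tubeEval_smul (f : MvPolynomial (Fin d) ℝ) (θ η : EuclideanSpace ℝ (Fin d)) :
    ContDiff ℝ (⊤ : ℕ∞) fun s : ℝ => tubeEval f θ (s • η) := by
  refine ((contDiff_aeval_complex f).restrict_scalars ℝ).comp (contDiff_pi.2 fun j => ?_)
  simp only [PiLp.smul_apply, smul_eq_mul, Complex.ofReal_mul]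
  exact contDiff_const.add (contDiff_const.mul (Complex.ofRealCLM.contDiff.mul contDiff_const))

theorem continuous_tubeEval (f : MvPolynomial (Fin d) ℝ) :
    Continuous fun a : EuclideanSpace ℝ (Fin d) × EuclideanSpace ℝ (Fin d) =>
      tubeEval f a.1 a.2 :=
  (continuous_aeval_complex f).comp (by fun_prop)

theorem tubeEval_zero (f : MvPolynomial (Fin d) ℝ) (θ : EuclideanSpace ℝ (Fin d)) :
    tubeEval f θ 0 = (MvPolynomial.eval θ f : ℂ) := by
  rw [← aeval_ofReal]
  simp [tubeEval]

theorem continuous_logDeriv_tubeEval (h : IsHyperbolicAt f τ) (hθ : θ ∈ hyperbolicityCone f τ)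
    (η : EuclideanSpace ℝ (Fin d)) :
    Continuous (logDeriv fun s : ℝ => tubeEval f θ (s • η)) :=
  ((contDiff_tubeEval_smul f θ η).continuous_deriv (by simp)).div
    (contDiff_tubeEval_smul f θ η).continuous fun s => h.tubeEval_ne_zero hθ _

/-- With g the restriction of f to the segment, g · exp(-∫ g'/g) has zero derivative; comparing its
values at 0 and 1 gives the claim. -/
theorem exp_tubeLog (h : IsHyperbolicAt f τ) (hτ : 0 < MvPolynomial.eval τ f)
    (hθ : θ ∈ hyperbolicityCone f τ) (η : EuclideanSpace ℝ (Fin d)) :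
    Complex.exp (tubeLog f θ η) = tubeEval f θ η := by
  have hc := continuous_logDeriv_tubeEval h hθ η
  set g : ℝ → ℂ := fun s => tubeEval f θ (s • η) with hg
  have hg0 : ∀ s, g s ≠ 0 := fun s => h.tubeEval_ne_zero hθ _
  have hd : ∀ s : ℝ, HasDerivAt
      (fun s => g s * Complex.exp (-∫ t in (0 : ℝ)..s, logDeriv g t)) 0 s := by
    intro s
    have h1 : HasDerivAt (fun s => ∫ t in (0 : ℝ)..s, logDeriv g t) (logDeriv g s) s :=
      hc.integral_hasStrictDerivAt 0 s |>.hasDerivAt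
    have h2 : HasDerivAt g (deriv g s) s :=
      ((contDiff_tubeEval_smul f θ η).differentiable (by simp) s).hasDerivAt
    convert! h2.mul h1.neg.cexp using 1
    rw [logDeriv_apply]
    field_simp [hg0 s]
    ring
  have hconst := is_const_of_deriv_eq_zero (fun s => (hd s).differentiableAt)
    (fun s => (hd s).deriv) 1 0
  have hpos := eval_pos_of_mem_hyperbolicityCone hτ hθ
  simp only [intervalIntegral.integral_same, neg_zero, Complex.exp_zero, mul_one, hg, one_smul,
    zero_smul, tubeEval_zero] at hconst
  rw [tubeLog, Complex.exp_add, Complex.ofReal_log hpos.le, Complex.exp_log (by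
    exact_mod_cast hpos.ne'), ← hconst, mul_assoc, ← Complex.exp_add]
  simp

/-- Near a base point of the tube, the branch of the logarithm is the principal logarithm of the
quotient, up to a constant. -/
theorem eventually_tubeLog_eq (h : IsHyperbolicAt f τ) (hτ : 0 < MvPolynomial.eval τ f)
    (hθ : θ ∈ hyperbolicityCone f τ) (η : EuclideanSpace ℝ (Fin d)) :
    ∀ᶠ a : EuclideanSpace ℝ (Fin d) × EuclideanSpace ℝ (Fin d) in 𝓝 (θ, η),
      tubeLog f a.1 a.2 =
        tubeLog f θ η + Complex.log (tubeEval f a.1 a.2 / tubeEval f θ η) := by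
  have hcone : ∀ᶠ a : EuclideanSpace ℝ (Fin d) × EuclideanSpace ℝ (Fin d) in 𝓝 (θ, η),
      a.1 ∈ hyperbolicityCone f τ :=
    continuous_fst.continuousAt.eventually_mem ((isOpen_hyperbolicityCone f τ).mem_nhds hθ)
  -- Compactness of [0, 1] keeps the quotient of the two segment functions off the branch cut for
  -- all s at once, so its principal logarithm is an antiderivative of the difference of logarithmic
  -- derivatives.
  have hslit : ∀ᶠ a : EuclideanSpace ℝ (Fin d) × EuclideanSpace ℝ (Fin d) in 𝓝 (θ, η),
      ∀ s ∈ Set.Icc (0 : ℝ) 1,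
        tubeEval f a.1 (s • a.2) / tubeEval f θ (s • η) ∈ Complex.slitPlane := by
    refine isCompact_Icc.eventually_forall_of_forall_eventually fun s hs => ?_
    have hc : Continuous fun b : (EuclideanSpace ℝ (Fin d) × EuclideanSpace ℝ (Fin d)) × ℝ =>
        tubeEval f b.1.1 (b.2 • b.1.2) / tubeEval f θ (b.2 • η) := by
      refine Continuous.div ?_ ?_ fun b => h.tubeEval_ne_zero hθ _
      · exact (continuous_tubeEval f).comp
          (f := fun b : (EuclideanSpace ℝ (Fin d) × EuclideanSpace ℝ (Fin d)) × ℝ =>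
            (b.1.1, b.2 • b.1.2)) (by fun_prop)
      · exact (continuous_tubeEval f).comp
          (f := fun b : (EuclideanSpace ℝ (Fin d) × EuclideanSpace ℝ (Fin d)) × ℝ =>
            (θ, b.2 • η)) (by fun_prop)
    refine hc.continuousAt.eventually_mem (Complex.isOpen_slitPlane.mem_nhds ?_)
    simp only
    rw [div_self (h.tubeEval_ne_zero hθ _)]
    exact Complex.one_mem_slitPlane
  filter_upwards [hcone, hslit] with a ha hs
  have hc1 := continuous_logDeriv_tubeEval h ha a.2
  have hc0 := continuous_logDeriv_tubeEval h hθ η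
  have h1 := (contDiff_tubeEval_smul f a.1 a.2).differentiable (by simp)
  have h0 := (contDiff_tubeEval_smul f θ η).differentiable (by simp)
  have hn1 : ∀ s : ℝ, tubeEval f a.1 (s • a.2) ≠ 0 := fun s => h.tubeEval_ne_zero ha _
  have hn0 : ∀ s : ℝ, tubeEval f θ (s • η) ≠ 0 := fun s => h.tubeEval_ne_zero hθ _
  have hftc : ∫ s in (0 : ℝ)..1, (logDeriv (fun s : ℝ => tubeEval f a.1 (s • a.2)) s
      - logDeriv (fun s : ℝ => tubeEval f θ (s • η)) s) =
      Complex.log (tubeEval f a.1 ((1 : ℝ) • a.2) / tubeEval f θ ((1 : ℝ) • η)) -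
      Complex.log (tubeEval f a.1 ((0 : ℝ) • a.2) / tubeEval f θ ((0 : ℝ) • η)) := by
    refine intervalIntegral.integral_eq_sub_of_hasDerivAt
      (f := fun s : ℝ => Complex.log (tubeEval f a.1 (s • a.2) / tubeEval f θ (s • η)))
      (fun s hs' => ?_) ((hc1.sub hc0).intervalIntegrable 0 1)
    rw [Set.uIcc_of_le zero_le_one] at hs'
    have hd := ((h1 s).hasDerivAt.div (h0 s).hasDerivAt (hn0 s)).clog_real (hs s hs')
    convert! hd using 1
    rw [logDeriv_apply, logDeriv_apply]
    have := hn0 s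
    have := hn1 s
    simp only [Pi.div_apply]
    field_simp
  rw [intervalIntegral.integral_sub (hc1.intervalIntegrable 0 1) (hc0.intervalIntegrable 0 1)]
    at hftc
  have hp1 := eval_pos_of_mem_hyperbolicityCone hτ ha
  have hp0 := eval_pos_of_mem_hyperbolicityCone hτ hθ
  simp only [one_smul, zero_smul, tubeEval_zero] at hftc
  rw [← Complex.ofReal_div, ← Complex.ofReal_log (by positivity),
    Real.log_div hp1.ne' hp0.ne'] at hftc
  rw [tubeLog, tubeLog, sub_eq_iff_eq_add.1 hftc]
  push_cast
  ring

theorem norm_tubeNegPow (h : IsHyperbolicAt f τ) (hτ : 0 < MvPolynomial.eval τ f)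
    (hθ : θ ∈ hyperbolicityCone f τ) (α : ℝ) (η : EuclideanSpace ℝ (Fin d)) :
    ‖tubeNegPow f α θ η‖ = ‖tubeEval f θ η‖ ^ (-α) := by
  rw [← exp_tubeLog h hτ hθ, Complex.norm_exp, ← Real.exp_mul, tubeNegPow, Complex.norm_exp]
  congr 1
  rw [← Complex.ofReal_neg, Complex.re_ofReal_mul, mul_comm]

theorem norm_tubeNegPow_le (h : IsHyperbolicAt f τ) (hτ : 0 < MvPolynomial.eval τ f)
    (hθ : θ ∈ hyperbolicityCone f τ) {α : ℝ} (hα : 0 < α) (η : EuclideanSpace ℝ (Fin d)) :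
    ‖tubeNegPow f α θ η‖ ≤ MvPolynomial.eval θ f ^ (-α) := by
  rw [norm_tubeNegPow h hτ hθ]
  exact Real.rpow_le_rpow_of_nonpos (eval_pos_of_mem_hyperbolicityCone hτ hθ)
    ((le_abs_self _).trans (h.le_norm_tubeEval hθ η)) (by linarith)

theorem continuousAt_tubeNegPow (h : IsHyperbolicAt f τ) (hτ : 0 < MvPolynomial.eval τ f)
    (hθ : θ ∈ hyperbolicityCone f τ) (α : ℝ) (η : EuclideanSpace ℝ (Fin d)) :
    ContinuousAt (fun a : EuclideanSpace ℝ (Fin d) × EuclideanSpace ℝ (Fin d) =>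
      tubeNegPow f α a.1 a.2) (θ, η) := by
  have h1 : ContinuousAt (fun a : EuclideanSpace ℝ (Fin d) × EuclideanSpace ℝ (Fin d) =>
      tubeLog f a.1 a.2) (θ, η) := by
    refine ContinuousAt.congr ?_ (EventuallyEq.symm (eventually_tubeLog_eq h hτ hθ η))
    refine continuousAt_const.add (ContinuousAt.clog ?_ ?_)
    · exact (continuous_tubeEval f).continuousAt.div_const _
    · simp only
      rw [div_self (h.tubeEval_ne_zero hθ _)]
      exact Complex.one_mem_slitPlane
  exact (continuousAt_const.mul h1).cexp

theorem continuous_tubeNegPow (h : IsHyperbolicAt f τ) (hτ : 0 < MvPolynomial.eval τ f)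
    (hθ : θ ∈ hyperbolicityCone f τ) (α : ℝ) : Continuous (tubeNegPow f α θ) :=
  continuous_iff_continuousAt.2 fun η =>
    (continuousAt_tubeNegPow h hτ hθ α η).comp (f := fun η => (θ, η)) (by fun_prop)

/-- The pair of real points encodes the complex line θ + iη + ζv, on which f is a polynomial in ζ;
locally the branch is a principal logarithm of it, hence holomorphic. -/
theorem differentiableAt_tubeNegPow (h : IsHyperbolicAt f τ) (hτ : 0 < MvPolynomial.eval τ f)
    (α : ℝ) {v : EuclideanSpace ℝ (Fin d)} {ζ₀ : ℂ}
    (hθ : θ + ζ₀.re • v ∈ hyperbolicityCone f τ) (η : EuclideanSpace ℝ (Fin d)) :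
    DifferentiableAt ℂ (fun ζ : ℂ => tubeNegPow f α (θ + ζ.re • v) (η + ζ.im • v)) ζ₀ := by
  have hev := eventually_tubeLog_eq h hτ hθ (η + ζ₀.im • v)
  have hc : Tendsto (fun ζ : ℂ => (θ + ζ.re • v, η + ζ.im • v)) (𝓝 ζ₀)
      (𝓝 (θ + ζ₀.re • v, η + ζ₀.im • v)) :=
    (Continuous.tendsto (by fun_prop) ζ₀)
  have heval : ∀ ζ : ℂ, tubeEval f (θ + ζ.re • v) (η + ζ.im • v) = MvPolynomial.aeval
      (fun j => (θ j + Complex.I * η j : ℂ) + ζ * (v j : ℂ)) f := by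
    intro ζ
    rw [tubeEval]
    congr 2
    funext j
    simp only [PiLp.add_apply, PiLp.smul_apply, smul_eq_mul]
    push_cast
    conv_rhs => rw [← Complex.re_add_im ζ]
    ring
  have h1 : DifferentiableAt ℂ (fun ζ : ℂ => tubeLog f (θ + ζ.re • v) (η + ζ.im • v)) ζ₀ := by
    refine DifferentiableAt.congr_of_eventuallyEq ?_ (hc.eventually hev)
    refine (differentiableAt_const _).add (DifferentiableAt.clog ?_ ?_)
    · simp only [heval]
      refine DifferentiableAt.div_const ?_ _
      exact ((contDiff_aeval_complex f).differentiable (by simp)).comp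
        (f := fun ζ : ℂ => fun j => (θ j + Complex.I * η j : ℂ) + ζ * (v j : ℂ))
        (by fun_prop) ζ₀
    · rw [div_self (h.tubeEval_ne_zero hθ _)]
      exact Complex.one_mem_slitPlane
  exact ((differentiableAt_const _).mul h1).cexp

end TubeLogarithm

/-! ### Gaussian regularization and independence of the base point -/

section ContourShift

open Filter Topology

variable {d : ℕ} {f : MvPolynomial (Fin d) ℝ} {τ θ : EuclideanSpace ℝ (Fin d)}

/-- The entire function `exp (a z·z + z·σ)` at `z = θ + i η`. -/
def tubeGaussian (a : ℝ) (σ θ η : EuclideanSpace ℝ (Fin d)) : ℂ :=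
  Complex.exp (∑ j, ((a : ℂ) * ((θ j : ℂ) + Complex.I * (η j : ℂ)) ^ 2 +
    ((θ j : ℂ) + Complex.I * (η j : ℂ)) * (σ j : ℂ)))

theorem tubeGaussian_eq (a : ℝ) (σ θ η : EuclideanSpace ℝ (Fin d)) :
    tubeGaussian a σ θ η = (Real.exp (a * ‖θ‖ ^ 2 + inner ℝ θ σ) : ℝ) *
      (Complex.exp (-(a : ℂ) * ‖η‖ ^ 2) *
        Complex.exp (Complex.I * (inner ℝ η ((2 * a) • θ + σ) : ℝ))) := by
  rw [tubeGaussian, Complex.ofReal_exp, ← Complex.exp_add, ← Complex.exp_add]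
  congr 1
  rw [inner_add_right, inner_smul_right]
  simp only [PiLp.inner_apply, RCLike.inner_apply, conj_trivial, ← Complex.ofReal_pow,
    EuclideanSpace.real_norm_sq_eq]
  push_cast
  simp only [Finset.mul_sum, ← Finset.sum_add_distrib]
  refine Finset.sum_congr rfl fun j _ => ?_
  ring_nf
  simp only [Complex.I_sq]
  ring

theorem norm_tubeGaussian (a : ℝ) (σ θ η : EuclideanSpace ℝ (Fin d)) :
    ‖tubeGaussian a σ θ η‖ =
      Real.exp (a * ‖θ‖ ^ 2 + inner ℝ θ σ) * Real.exp (-a * ‖η‖ ^ 2) := by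
  rw [tubeGaussian_eq, norm_mul, norm_mul, Complex.norm_real, Real.norm_of_nonneg (by positivity)]
  congr 1
  rw [mul_comm Complex.I, Complex.norm_exp_ofReal_mul_I, mul_one, Complex.norm_exp]
  congr 1
  rw [← Complex.ofReal_neg, ← Complex.ofReal_pow, ← Complex.ofReal_mul, Complex.ofReal_re]

theorem continuous_tubeGaussian (a : ℝ) (σ θ : EuclideanSpace ℝ (Fin d)) :
    Continuous (tubeGaussian a σ θ) := by
  unfold tubeGaussian
  fun_prop

theorem differentiable_tubeGaussian (a : ℝ) (σ θ η v : EuclideanSpace ℝ (Fin d)) :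
    Differentiable ℂ (fun ζ : ℂ => tubeGaussian a σ (θ + ζ.re • v) (η + ζ.im • v)) := by
  have heval : (fun ζ : ℂ => tubeGaussian a σ (θ + ζ.re • v) (η + ζ.im • v)) = fun ζ : ℂ =>
      Complex.exp (∑ j, ((a : ℂ) * ((θ j + Complex.I * η j : ℂ) + ζ * (v j : ℂ)) ^ 2 +
        ((θ j + Complex.I * η j : ℂ) + ζ * (v j : ℂ)) * (σ j : ℂ))) := by
    funext ζ
    rw [tubeGaussian]
    congr 1
    refine Finset.sum_congr rfl fun j _ => ?_
    have : (((θ + ζ.re • v) j : ℝ) : ℂ) + Complex.I * (((η + ζ.im • v) j : ℝ) : ℂ) =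
        (θ j + Complex.I * η j : ℂ) + ζ * (v j : ℂ) := by
      simp only [PiLp.add_apply, PiLp.smul_apply, smul_eq_mul]
      push_cast
      conv_rhs => rw [← Complex.re_add_im ζ]
      ring
    rw [this]
  rw [heval]
  fun_prop

theorem integrable_gaussian_norm {V : Type*} [NormedAddCommGroup V] [InnerProductSpace ℝ V]
    [FiniteDimensional ℝ V] [MeasurableSpace V] [BorelSpace V] {a : ℝ} (ha : 0 < a) :
    Integrable fun v : V => Real.exp (-a * ‖v‖ ^ 2) := by
  have := (GaussianFourier.integrable_cexp_neg_mul_sq_norm_add (b := (a : ℂ)) (by simpa using ha)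
    0 (0 : V)).norm
  refine this.congr (Eventually.of_forall fun v => ?_)
  simp only [zero_mul, add_zero, Complex.norm_exp]
  congr 1
  rw [← Complex.ofReal_neg, ← Complex.ofReal_pow, ← Complex.ofReal_mul, Complex.ofReal_re]

/-- The Gaussian regularization of the Fourier--Laplace integral over `θ + i ℝᵈ`. -/
def gaussianTubeIntegral (f : MvPolynomial (Fin d) ℝ) (α a : ℝ)
    (σ θ : EuclideanSpace ℝ (Fin d)) : ℂ :=
  ∫ η : EuclideanSpace ℝ (Fin d), tubeNegPow f α θ η * tubeGaussian a σ θ η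

/-- Vanishing derivative of the regularized integral along a line in the cone. -/
theorem hasDerivAt_gaussianTubeIntegral (h : IsHyperbolicAt f τ)
    (hτ : 0 < MvPolynomial.eval τ f) {α a : ℝ} (hα : 0 < α) (ha : 0 < a)
    (σ : EuclideanSpace ℝ (Fin d)) {v : EuclideanSpace ℝ (Fin d)} {s : ℝ}
    (hθ : θ + s • v ∈ hyperbolicityCone f τ) :
    HasDerivAt (fun s : ℝ => gaussianTubeIntegral f α a σ (θ + s • v)) 0 s := by
  set H : ℂ → EuclideanSpace ℝ (Fin d) → ℂ := fun ζ η =>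
    tubeNegPow f α (θ + ζ.re • v) (η + ζ.im • v) *
      tubeGaussian a σ (θ + ζ.re • v) (η + ζ.im • v) with hH
  have hfs : 0 < MvPolynomial.eval (θ + s • v) f := eval_pos_of_mem_hyperbolicityCone hτ hθ
  set m := MvPolynomial.eval (θ + s • v) f with hm
  set M := ‖θ + s • v‖ + 1 with hM
  have hpath : Continuous fun ζ : ℂ => θ + ζ.re • v := by fun_prop
  have hs : θ + ((s : ℂ)).re • v = θ + s • v := by simp
  obtain ⟨ε, hε, hball⟩ : ∃ ε > 0, ∀ ζ : ℂ, dist ζ (s : ℂ) < ε →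
      (θ + ζ.re • v ∈ hyperbolicityCone f τ ∧ m / 2 < MvPolynomial.eval (θ + ζ.re • v) f ∧
        ‖θ + ζ.re • v‖ < M) := by
    refine Metric.eventually_nhds_iff.1 ?_
    refine Eventually.and ?_ (Eventually.and ?_ ?_)
    · refine hpath.continuousAt.eventually_mem ((isOpen_hyperbolicityCone f τ).mem_nhds ?_)
      rwa [hs]
    · refine ((continuous_eval_euclidean f).comp hpath).continuousAt.eventually_const_lt ?_
      simp only [Function.comp_apply]
      rw [hs]
      linarith
    · refine hpath.norm.continuousAt.eventually_lt_const ?_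
      simp only
      rw [hs]
      linarith
  -- Discs of radius r around points of the r-disc at s stay within ε, where the bounds hold, and
  -- within |Im ζ| ≤ 2.
  set r := min (ε / 2) 1 with hr
  have hr0 : 0 < r := by positivity
  have hr1 : r ≤ 1 := min_le_right _ _
  have hr2 : r + r ≤ ε := by linarith [min_le_left (ε / 2) 1]
  set K : ℝ := (m / 2) ^ (-α) * Real.exp (a * M ^ 2 + M * ‖σ‖ + a * (2 * ‖v‖) ^ 2) with hK
  -- Translating η by at most 2‖v‖ costs half the Gaussian rate and the constant a(2‖v‖)² in `K`.
  have hbound : ∀ ζ : ℂ, dist ζ (s : ℂ) < ε → |ζ.im| ≤ 2 → ∀ η,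
      ‖H ζ η‖ ≤ K * Real.exp (-(a / 2) * ‖η‖ ^ 2) := by
    intro ζ hζ him η
    obtain ⟨h1, h2, h3⟩ := hball ζ hζ
    have h4 : ‖tubeNegPow f α (θ + ζ.re • v) (η + ζ.im • v)‖ ≤ (m / 2) ^ (-α) :=
      (norm_tubeNegPow_le h hτ h1 hα _).trans
        (Real.rpow_le_rpow_of_nonpos (by positivity) h2.le (by linarith))
    have h5 : ‖η‖ ^ 2 ≤ 2 * ‖η + ζ.im • v‖ ^ 2 + 2 * (2 * ‖v‖) ^ 2 := by
      have h6 : ‖η‖ ≤ ‖η + ζ.im • v‖ + 2 * ‖v‖ := by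
        calc ‖η‖ = ‖(η + ζ.im • v) - ζ.im • v‖ := by rw [add_sub_cancel_right]
          _ ≤ ‖η + ζ.im • v‖ + ‖ζ.im • v‖ := norm_sub_le _ _
          _ ≤ _ := by
            rw [norm_smul, Real.norm_eq_abs]
            gcongr
      have h7 := norm_nonneg η
      nlinarith [sq_nonneg (‖η + ζ.im • v‖ - 2 * ‖v‖)]
    have h8 : inner ℝ (θ + ζ.re • v) σ ≤ M * ‖σ‖ :=
      (real_inner_le_norm _ _).trans (by gcongr)
    rw [hH, hK]
    simp only [norm_mul, norm_tubeGaussian]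
    rw [mul_assoc, ← Real.exp_add, ← Real.exp_add]
    refine mul_le_mul h4 (Real.exp_le_exp.2 ?_) (Real.exp_nonneg _) (by positivity)
    have h9 : a * ‖θ + ζ.re • v‖ ^ 2 ≤ a * M ^ 2 := by gcongr
    nlinarith
  have hHdiff : ∀ ζ : ℂ, dist ζ (s : ℂ) < ε → ∀ η, DifferentiableAt ℂ (H · η) ζ :=
    fun ζ hζ η => (differentiableAt_tubeNegPow h hτ α (hball ζ hζ).1 η).mul
      (differentiable_tubeGaussian a σ θ η v ζ)
  have hHcont : ∀ ζ : ℂ, dist ζ (s : ℂ) < ε → Continuous (H ζ) := by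
    intro ζ hζ
    have h1 : Continuous fun η : EuclideanSpace ℝ (Fin d) => η + ζ.im • v := by fun_prop
    exact ((continuous_tubeNegPow h hτ (hball ζ hζ).1 α).comp h1).mul
      ((continuous_tubeGaussian a σ _).comp h1)
  have hgauss : Integrable fun η : EuclideanSpace ℝ (Fin d) =>
      K * Real.exp (-(a / 2) * ‖η‖ ^ 2) := (integrable_gaussian_norm (by positivity)).const_mul K
  have hsε : dist (s : ℂ) (s : ℂ) < ε := by simpa using hε
  have hnear : ∀ᶠ ζ in 𝓝 (s : ℂ), dist ζ (s : ℂ) < ε := Metric.ball_mem_nhds _ hε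
  have hderiv := (hasDerivAt_integral_of_dominated_loc_of_deriv_le (μ := volume) (F := H)
    (F' := fun ζ η => deriv (H · η) ζ)
    (bound := fun η => (K * Real.exp (-(a / 2) * ‖η‖ ^ 2)) / r)
    (Metric.ball_mem_nhds (s : ℂ) hr0)
    (hnear.mono fun ζ hζ => (hHcont ζ hζ).aestronglyMeasurable)
    (hgauss.mono' (hHcont _ hsε).aestronglyMeasurable
      (Eventually.of_forall fun η => hbound _ hsε (by simp) η)) ?_ ?_
    (hgauss.div_const r) ?_).2
  -- Im ζ only translates η, so the integral is constant in the imaginary direction. Being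
  -- holomorphic in ζ, it has derivative `D` with D · i = 0.
  · have hI : ∀ ζ : ℂ, ∫ η, H ζ η = gaussianTubeIntegral f α a σ (θ + ζ.re • v) := by
      intro ζ
      exact integral_add_right_eq_self (fun η => tubeNegPow f α (θ + ζ.re • v) η *
        tubeGaussian a σ (θ + ζ.re • v) η) (ζ.im • v)
    simp only [hI] at hderiv
    set D := ∫ η, deriv (H · η) (s : ℂ)
    have hvert : HasDerivAt (fun u : ℝ => (s : ℂ) + u * Complex.I) Complex.I 0 := by
      simpa using ((Complex.ofRealCLM.hasDerivAt (x := (0 : ℝ))).mul_const Complex.I).const_add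
        (s : ℂ)
    have h1 := HasDerivAt.comp (𝕜' := ℂ) (0 : ℝ) (h₂ := fun ζ : ℂ =>
      gaussianTubeIntegral f α a σ (θ + ζ.re • v)) (h₂' := D) (by simpa using hderiv) hvert
    have h2 : ((fun ζ : ℂ => gaussianTubeIntegral f α a σ (θ + ζ.re • v)) ∘
        fun u : ℝ => (s : ℂ) + u * Complex.I) =
        fun _ => gaussianTubeIntegral f α a σ (θ + s • v) := by
      funext u
      simp
    rw [h2] at h1
    have h3 : D = 0 := by
      have := h1.unique (hasDerivAt_const (0 : ℝ) _)
      simpa using this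
    have h4 := HasDerivAt.comp_ofReal hderiv
    rw [h3] at h4
    simpa using h4
  -- Measurability of the derivative in η: it is a pointwise limit of continuous difference
  -- quotients.
  · have hlim : ∀ η, Tendsto (fun n : ℕ => ((1 / ((n : ℂ) + 1))⁻¹) *
        (H (s + 1 / ((n : ℂ) + 1)) η - H s η)) atTop (𝓝 (deriv (H · η) s)) := by
      intro η
      have h1 := (hHdiff _ hsε η).hasDerivAt.tendsto_slope_zero
      have h2 : Tendsto (fun n : ℕ => 1 / ((n : ℂ) + 1)) atTop (𝓝[≠] 0) := by
        refine tendsto_nhdsWithin_iff.2 ⟨tendsto_one_div_add_atTop_nhds_zero_nat, ?_⟩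
        exact Eventually.of_forall fun n => by
          have : (n : ℂ) + 1 ≠ 0 := by exact_mod_cast n.succ_ne_zero
          simpa using this
      exact h1.comp h2
    have h3 : Tendsto (fun n : ℕ => (s : ℂ) + 1 / ((n : ℂ) + 1)) atTop (𝓝 s) := by
      simpa using tendsto_one_div_add_atTop_nhds_zero_nat (𝕜 := ℂ) |>.const_add (s : ℂ)
    obtain ⟨N, hN⟩ := (h3.eventually hnear).exists_forall_of_atTop
    refine aestronglyMeasurable_of_tendsto_ae atTop
      (f := fun (n : ℕ) η => ((1 / (((n + N : ℕ) : ℂ) + 1))⁻¹) *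
        (H (s + 1 / (((n + N : ℕ) : ℂ) + 1)) η - H s η)) (fun n => ?_)
      (Eventually.of_forall fun η => (hlim η).comp (tendsto_add_atTop_nat N))
    exact (continuous_const.mul ((hHcont _ (hN (n + N) (by omega))).sub
      (hHcont _ hsε))).aestronglyMeasurable
  · refine Eventually.of_forall fun η ζ hζ => ?_
    have hζ' : dist ζ (s : ℂ) < r := hζ
    have hsub : ∀ w ∈ Metric.closedBall ζ r, dist w (s : ℂ) < r + r := fun w hw =>
      (dist_triangle w ζ s).trans_lt (add_lt_add_of_le_of_lt hw hζ')
    -- Cauchy's estimate on a circle of radius r turns the bound on `H` into one on its derivative.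
    refine Complex.norm_deriv_le_of_forall_mem_sphere_norm_le hr0 ?_ fun w hw => ?_
    · refine DifferentiableOn.diffContOnCl fun w hw => ?_
      have hw' := Metric.closure_ball_subset_closedBall hw
      exact (hHdiff w ((hsub w hw').trans_le hr2) η).differentiableWithinAt
    · have hd := hsub w (Metric.sphere_subset_closedBall hw)
      refine hbound w (hd.trans_le hr2) ?_ η
      have := Complex.abs_im_le_norm (w - s)
      rw [Complex.sub_im, Complex.ofReal_im, sub_zero, ← dist_eq_norm] at this
      linarith
  · refine Eventually.of_forall fun η ζ hζ => ?_
    have hζ' : dist ζ (s : ℂ) < r := hζ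
    exact (hHdiff ζ (by linarith) η).hasDerivAt

/-- The regularized integral does not depend on the point of the cone. -/
theorem gaussianTubeIntegral_eq (h : IsHyperbolicAt f τ)
    (hτ : 0 < MvPolynomial.eval τ f) {α a : ℝ} (hα : 0 < α) (ha : 0 < a)
    (σ : EuclideanSpace ℝ (Fin d)) {θ θ' : EuclideanSpace ℝ (Fin d)}
    (hθ : θ ∈ hyperbolicityCone f τ) (hθ' : θ' ∈ hyperbolicityCone f τ) :
    gaussianTubeIntegral f α a σ θ' = gaussianTubeIntegral f α a σ θ := by
  have hpre : IsPreconnected (hyperbolicityCone f τ) := isPreconnected_connectedComponentIn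
  have hlocal : ∀ z ∈ hyperbolicityCone f τ, ∀ᶠ w in 𝓝 z, w ∈ hyperbolicityCone f τ ∧
      gaussianTubeIntegral f α a σ w = gaussianTubeIntegral f α a σ z := by
    intro z hz
    obtain ⟨r, hr, hball⟩ := Metric.isOpen_iff.1 (isOpen_hyperbolicityCone f τ) z hz
    filter_upwards [Metric.ball_mem_nhds z hr] with w hw
    refine ⟨hball hw, ?_⟩
    -- Only convexity of small balls is used; connectedness of the cone then makes the locally
    -- constant integral constant.
    have hseg : ∀ s ∈ Set.Icc (0 : ℝ) 1, z + s • (w - z) ∈ hyperbolicityCone f τ := fun s hs =>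
      hball ((convex_ball z r).add_smul_sub_mem (Metric.mem_ball_self hr) hw hs)
    have hd := fun s hs => hasDerivAt_gaussianTubeIntegral h hτ hα ha σ (hseg s hs)
    have := constant_of_has_deriv_right_zero (a := (0 : ℝ)) (b := 1)
      (fun s hs => (hd s hs).continuousAt.continuousWithinAt)
      (fun s hs => (hd s (Set.Ico_subset_Icc_self hs)).hasDerivWithinAt) 1 ⟨zero_le_one, le_rfl⟩
    simpa using this
  have hsub : hyperbolicityCone f τ ⊆ {w | w ∈ hyperbolicityCone f τ ∧
      gaussianTubeIntegral f α a σ w = gaussianTubeIntegral f α a σ θ} := by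
    refine hpre.subset_of_closure_inter_subset ?_ ⟨θ, hθ, hθ, rfl⟩ ?_
    · rw [isOpen_iff_mem_nhds]
      rintro z ⟨hz, hze⟩
      filter_upwards [hlocal z hz] with w hw
      exact ⟨hw.1, hw.2.trans hze⟩
    · rintro z ⟨hz1, hz2⟩
      obtain ⟨w, hw1, hw2⟩ := mem_closure_iff_nhds.1 hz1 _ (hlocal z hz2)
      exact ⟨hz2, hw1.2.symm.trans hw2.2⟩
  exact (hsub hθ').2

end ContourShift

/-! ### Positive definite limits and their pullbacks -/

section PositiveDefinite

open Filter Topology Real FourierTransform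
open scoped ComplexOrder

variable {V W : Type*} [NormedAddCommGroup V] [InnerProductSpace ℝ V] [FiniteDimensional ℝ V]
  [MeasurableSpace V] [BorelSpace V] [NormedAddCommGroup W] [InnerProductSpace ℝ W]
  [FiniteDimensional ℝ W] [MeasurableSpace W] [BorelSpace W]

theorem fourier_gaussian_nonneg {b : ℝ} (hb : 0 < b) (x w : V) :
    0 ≤ 𝓕 (fun v : V => Complex.exp (-(b : ℂ) * ‖v‖ ^ 2 +
      2 * π * Complex.I * (inner ℝ x v : ℝ))) w := by
  rw [fourier_gaussian_innerProductSpace' (by simpa using hb)]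
  have h1 : ((π : ℂ) / b) ^ (Module.finrank ℝ V / 2 : ℂ) =
      (((π / b) ^ (Module.finrank ℝ V / 2 : ℝ) : ℝ) : ℂ) := by
    rw [Complex.ofReal_cpow (by positivity)]
    push_cast
    rfl
  have h2 : Complex.exp (-π ^ 2 * ‖x - w‖ ^ 2 / b) =
      ((Real.exp (-π ^ 2 * ‖x - w‖ ^ 2 / b) : ℝ) : ℂ) := by
    push_cast
    rfl
  rw [h1, h2, ← Complex.ofReal_mul]
  exact Complex.zero_le_real.2 (by positivity)

theorem integrable_gaussian_modulated {b : ℝ} (hb : 0 < b) (x : V) :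
    Integrable (fun v : V => Complex.exp (-(b : ℂ) * ‖v‖ ^ 2 +
      2 * π * Complex.I * (inner ℝ x v : ℝ))) :=
  GaussianFourier.integrable_cexp_neg_mul_sq_norm_add (by simpa using hb) _ _

theorem continuous_gaussian_modulated {V : Type*} [NormedAddCommGroup V] [InnerProductSpace ℝ V]
    (b : ℝ) (x : V) :
    Continuous (fun v : V => Complex.exp (-(b : ℂ) * ‖v‖ ^ 2 +
      2 * π * Complex.I * (inner ℝ x v : ℝ))) := by
  fun_prop

theorem integrable_fourier_gaussian {b : ℝ} (hb : 0 < b) (x : V) :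
    Integrable (𝓕 (fun v : V => Complex.exp (-(b : ℂ) * ‖v‖ ^ 2 +
      2 * π * Complex.I * (inner ℝ x v : ℝ)))) := by
  have h1 : 𝓕 (fun v : V => Complex.exp (-(b : ℂ) * ‖v‖ ^ 2 +
      2 * π * Complex.I * (inner ℝ x v : ℝ))) = fun w =>
      (π / b) ^ (Module.finrank ℝ V / 2 : ℂ) * Complex.exp (-π ^ 2 * ‖x - w‖ ^ 2 / b) := by
    funext w
    exact fourier_gaussian_innerProductSpace' (by simpa using hb) x w
  rw [h1]
  refine Integrable.const_mul ?_ _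
  have h2 := (integrable_gaussian_modulated (b := π ^ 2 / b) (by positivity) (0 : V)).comp_sub_left x
  refine h2.congr (Eventually.of_forall fun w => ?_)
  simp only [inner_zero_left]
  congr 1
  push_cast
  ring

theorem norm_gaussian_cexp {V : Type*} [NormedAddCommGroup V] (b : ℝ) (v : V) :
    ‖Complex.exp (-(b : ℂ) * ‖v‖ ^ 2)‖ = Real.exp (-b * ‖v‖ ^ 2) := by
  rw [Complex.norm_exp]
  congr 1
  rw [← Complex.ofReal_neg, ← Complex.ofReal_pow, ← Complex.ofReal_mul, Complex.ofReal_re]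

theorem integral_fourier_mul_eq {f g : V → ℂ} (hf : Integrable f) (hg : Integrable g) :
    ∫ x, 𝓕 f x * g x = ∫ x, f x * 𝓕 g x := by
  simpa using! VectorFourier.integral_fourierIntegral_smul_eq_flip (L := innerₗ V)
    Real.continuous_fourierChar continuous_inner hf hg

/-- An integrable bounded continuous function with nonnegative Fourier transform has an integrable
Fourier transform. -/
theorem integrable_fourier_of_nonneg {g : V → ℂ} (hg : Integrable g) {C : ℝ}
    (hC : ∀ x, ‖g x‖ ≤ C) (hpos : ∀ s, 0 ≤ 𝓕 g s) : Integrable (𝓕 g) := by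
  have hcont : Continuous (𝓕 g) :=
    VectorFourier.fourierIntegral_continuous continuous_fourierChar
      (by exact continuous_inner) hg
  have hbd : ∀ s, ‖𝓕 g s‖ ≤ ∫ x, ‖g x‖ := fun s =>
    VectorFourier.norm_fourierIntegral_le_integral_norm _ _ _ _ _
  -- Moving the transform onto the Gaussian G gives ∫ G · 𝓕g = ∫ 𝓕G · g ≤ C ∫ 𝓕G = C · G(0) = C,
  -- uniformly in b. Nonnegativity makes the left side an L¹ norm, and Fatou's lemma lets b → 0.
  have key : ∀ b : ℝ, 0 < b → Integrable (fun w => Complex.exp (-(b : ℂ) * ‖w‖ ^ 2) * 𝓕 g w) ∧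
      ∫ w, ‖Complex.exp (-(b : ℂ) * ‖w‖ ^ 2) * 𝓕 g w‖ ≤ C := by
    intro b hb
    have hGint := integrable_gaussian_modulated hb (0 : V)
    have hGc := continuous_gaussian_modulated b (0 : V)
    have hGpos := fourier_gaussian_nonneg hb (0 : V)
    have hGF := integrable_fourier_gaussian hb (0 : V)
    simp only [inner_zero_left, Complex.ofReal_zero, mul_zero, add_zero] at hGint hGc hGpos hGF
    set G : V → ℂ := fun v => Complex.exp (-(b : ℂ) * ‖v‖ ^ 2) with hG
    have hint : Integrable (fun w => G w * 𝓕 g w) :=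
      hGint.mul_bdd (c := ∫ x, ‖g x‖) hcont.aestronglyMeasurable (Eventually.of_forall hbd)
    refine ⟨hint, ?_⟩
    have h1 : ((∫ w, ‖G w * 𝓕 g w‖ : ℝ) : ℂ) = ∫ w, G w * 𝓕 g w := by
      rw [← integral_complex_ofReal]
      refine integral_congr_ae (Eventually.of_forall fun w => ?_)
      have h2 : G w = (‖G w‖ : ℂ) := by
        rw [hG]
        simp only [norm_gaussian_cexp]
        push_cast
        rfl
      simp only [norm_mul, Complex.ofReal_mul, ← h2]
      rw [← Complex.eq_coe_norm_of_nonneg (hpos w)]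
    have h3 : ∫ w, ‖𝓕 G w‖ = 1 := by
      have h4 : ((∫ w, ‖𝓕 G w‖ : ℝ) : ℂ) = 𝓕⁻ (𝓕 G) 0 := by
        rw [← integral_complex_ofReal, fourierInv_eq]
        refine integral_congr_ae (Eventually.of_forall fun w => ?_)
        simp only [inner_zero_right, AddChar.map_zero_eq_one, one_smul]
        exact (Complex.eq_coe_norm_of_nonneg (hGpos w)).symm
      rw [hGc.fourierInv_fourier_eq hGint hGF] at h4
      have h5 : G 0 = 1 := by simp [hG]
      rw [h5] at h4
      exact_mod_cast h4
    have h6 : ∫ w, G w * 𝓕 g w = ∫ w, 𝓕 G w * g w := (integral_fourier_mul_eq hGint hg).symm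
    have h7 : ‖∫ w, G w * 𝓕 g w‖ ≤ C := by
      rw [h6]
      calc ‖∫ w, 𝓕 G w * g w‖ ≤ ∫ w, ‖𝓕 G w‖ * C := by
            refine norm_integral_le_of_norm_le (hGF.norm.mul_const C)
              (Eventually.of_forall fun w => ?_)
            rw [norm_mul]
            exact mul_le_mul_of_nonneg_left (hC w) (norm_nonneg _)
        _ = C := by rw [integral_mul_const, h3, one_mul]
    rw [← h1, Complex.norm_real] at h7
    exact (le_abs_self _).trans h7
  have hb : ∀ n : ℕ, 0 < 1 / ((n : ℝ) + 1) := fun n => by positivity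
  have hlim : ∀ w, Tendsto (fun n : ℕ =>
      Complex.exp (-((1 / ((n : ℝ) + 1) : ℝ) : ℂ) * ‖w‖ ^ 2) * 𝓕 g w) atTop (𝓝 (𝓕 g w)) := by
    intro w
    have hc : Continuous fun b : ℝ => Complex.exp (-(b : ℂ) * ‖w‖ ^ 2) * 𝓕 g w := by fun_prop
    have := (hc.tendsto 0).comp (tendsto_one_div_add_atTop_nhds_zero_nat (𝕜 := ℝ))
    simpa [Function.comp_def] using this
  refine ⟨hcont.aestronglyMeasurable, ?_⟩
  have hfatou := lintegral_liminf_le' (μ := (volume : Measure V)) (u := atTop)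
    fun n : ℕ => (key _ (hb n)).1.1.aemeasurable.enorm
  have hliminf : ∀ w, liminf (fun n : ℕ => ‖Complex.exp (-((1 / ((n : ℝ) + 1) : ℝ) : ℂ) *
      ‖w‖ ^ 2) * 𝓕 g w‖ₑ) atTop = ‖𝓕 g w‖ₑ := fun w =>
    ((continuous_enorm.tendsto _).comp (hlim w)).liminf_eq
  simp only [hliminf] at hfatou
  refine hfatou.trans_lt ?_
  have hle : ∀ n : ℕ, ∫⁻ w, ‖Complex.exp (-((1 / ((n : ℝ) + 1) : ℝ) : ℂ) * ‖w‖ ^ 2) * 𝓕 g w‖ₑ ≤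
      ENNReal.ofReal C := by
    intro n
    rw [← ofReal_integral_norm_eq_lintegral_enorm (key _ (hb n)).1]
    exact ENNReal.ofReal_le_ofReal (key _ (hb n)).2
  refine lt_of_le_of_lt ?_ (ENNReal.ofReal_lt_top (r := C))
  exact (liminf_le_liminf (Eventually.of_forall hle)).trans (by simp)

/-- `g` is a bounded pointwise limit of Fourier transforms of nonnegative integrable functions. -/
def IsPositiveDefiniteLimit (g : V → ℂ) : Prop :=
  ∃ (p : ℕ → V → ℂ) (C : ℝ), (∀ n, Integrable (p n)) ∧ (∀ n s, 0 ≤ p n s) ∧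
    (∀ n x, ‖𝓕⁻ (p n) x‖ ≤ C) ∧ ∀ x, Tendsto (fun n => 𝓕⁻ (p n) x) atTop (𝓝 (g x))

theorem IsPositiveDefiniteLimit.of_fourier_nonneg {g : V → ℂ} (hg : Integrable g)
    (hc : Continuous g) {C : ℝ} (hC : ∀ x, ‖g x‖ ≤ C) (hpos : ∀ s, 0 ≤ 𝓕 g s) :
    IsPositiveDefiniteLimit g := by
  have hi := integrable_fourier_of_nonneg hg hC hpos
  have hinv := hc.fourierInv_fourier_eq hg hi
  exact ⟨fun _ => 𝓕 g, C, fun _ => hi, fun _ => hpos, fun _ x => by rw [hinv]; exact hC x,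
    fun x => by simp only [hinv]; exact tendsto_const_nhds⟩

/-- Each product k(δ·)g is integrable, bounded and has nonnegative transform, so that transform is
integrable and inversion applies; since k(0) = 1, the products tend to g as δ → 0. -/
theorem IsPositiveDefiniteLimit.of_regularization {g k : V → ℂ} (hc : Continuous g) {C B : ℝ}
    (hC : ∀ x, ‖g x‖ ≤ C) (hk : Integrable k) (hkc : Continuous k) (hB : ∀ x, ‖k x‖ ≤ B)
    (hk0 : k 0 = 1) (hpos : ∀ δ : ℝ, 0 < δ → ∀ s, 0 ≤ 𝓕 (fun w => k (δ • w) * g w) s) :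
    IsPositiveDefiniteLimit g := by
  have hC0 : 0 ≤ C := (norm_nonneg _).trans (hC 0)
  have hB0 : 0 ≤ B := (norm_nonneg _).trans (hB 0)
  have hδ : ∀ n : ℕ, 0 < 1 / ((n : ℝ) + 1) := fun n => by positivity
  set G : ℕ → V → ℂ := fun n w => k ((1 / ((n : ℝ) + 1)) • w) * g w with hG
  have hGc : ∀ n, Continuous (G n) := fun n => (hkc.comp (by fun_prop)).mul hc
  have hGi : ∀ n, Integrable (G n) := fun n =>
    (hk.comp_smul (hδ n).ne').mul_bdd (c := C) hc.aestronglyMeasurable (Eventually.of_forall hC)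
  have hGb : ∀ n x, ‖G n x‖ ≤ B * C := fun n x => by
    rw [hG]
    simp only [norm_mul]
    exact mul_le_mul (hB _) (hC x) (norm_nonneg _) hB0
  have hFi : ∀ n, Integrable (𝓕 (G n)) := fun n =>
    integrable_fourier_of_nonneg (hGi n) (hGb n) (hpos _ (hδ n))
  have hinv : ∀ n, 𝓕⁻ (𝓕 (G n)) = G n := fun n =>
    (hGc n).fourierInv_fourier_eq (hGi n) (hFi n)
  refine ⟨fun n => 𝓕 (G n), B * C, hFi, fun n => hpos _ (hδ n), fun n x => ?_, fun x => ?_⟩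
  · rw [hinv]
    exact hGb n x
  · simp only [hinv]
    have hc' : Continuous fun δ : ℝ => k (δ • x) * g x :=
      (hkc.comp (by fun_prop)).mul continuous_const
    have := (hc'.tendsto 0).comp (tendsto_one_div_add_atTop_nhds_zero_nat (𝕜 := ℝ))
    simpa [hG, Function.comp_def, hk0] using this

/-- The pullback of a positive definite limit along a linear map is nonnegative on Fourier
transforms of nonnegative functions. -/
theorem IsPositiveDefiniteLimit.integral_comp_mul_fourier_nonneg {g : V → ℂ}
    (hg : IsPositiveDefiniteLimit g) (A : W →L[ℝ] V) {ψ : W → ℂ} (hψ : Integrable ψ)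
    (hψc : Continuous ψ) (hψF : Integrable (𝓕 ψ)) (hψ0 : ∀ x, 0 ≤ ψ x) :
    0 ≤ ∫ η, g (A η) * 𝓕 ψ η := by
  obtain ⟨p, C, hpi, hp0, hpC, hlim⟩ := hg
  -- For the pairing -⟨v, Aw⟩, the transform of p is its inverse Fourier transform at Aη, and the
  -- flipped transform of 𝓕ψ is ψ composed with the adjoint. Fubini thus yields ∫ p(v) ψ(A*v) dv ≥
  -- 0.
  let L : V →L[ℝ] W →L[ℝ] ℝ := -(((innerSL ℝ).flip ∘L A).flip)
  have hL : ∀ v w, L v w = -inner ℝ v (A w) := fun v w => rfl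
  have h1 : ∀ n η, VectorFourier.fourierIntegral 𝐞 volume L.toLinearMap₁₂ (p n) η =
      𝓕⁻ (p n) (A η) := by
    intro n η
    rw [fourierInv_eq]
    refine integral_congr_ae (Eventually.of_forall fun v => ?_)
    change 𝐞 (-(L v η)) • p n v = 𝐞 (inner ℝ v (A η)) • p n v
    rw [hL, neg_neg]
  have h2 : ∀ v, VectorFourier.fourierIntegral 𝐞 volume L.toLinearMap₁₂.flip (𝓕 ψ) v =
      ψ (ContinuousLinearMap.adjoint A v) := by
    intro v
    rw [← congrFun (hψc.fourierInv_fourier_eq hψ hψF) (ContinuousLinearMap.adjoint A v),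
      fourierInv_eq]
    refine integral_congr_ae (Eventually.of_forall fun w => ?_)
    change 𝐞 (-(L v w)) • 𝓕 ψ w = 𝐞 (inner ℝ w (ContinuousLinearMap.adjoint A v)) • 𝓕 ψ w
    rw [hL, neg_neg, ContinuousLinearMap.adjoint_inner_right, real_inner_comm]
  have h3 : ∀ n, 0 ≤ ∫ η, 𝓕⁻ (p n) (A η) * 𝓕 ψ η := by
    intro n
    have := VectorFourier.integral_fourierIntegral_smul_eq_flip (L := L.toLinearMap₁₂)
      Real.continuous_fourierChar L.continuous₂ (hpi n) hψF
    simp only [h1, h2, smul_eq_mul] at this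
    rw [this]
    exact integral_nonneg fun v => mul_nonneg (hp0 n v) (hψ0 _)
  have h4 : ∀ n, Continuous (𝓕⁻ (p n)) := by
    intro n
    have : Continuous (𝓕 (p n)) :=
      VectorFourier.fourierIntegral_continuous continuous_fourierChar
        (by exact continuous_inner) (hpi n)
    have h5 : 𝓕⁻ (p n) = fun x => 𝓕 (p n) (-x) := funext fun x => fourierInv_eq_fourier_neg _ _
    rw [h5]
    exact this.comp continuous_neg
  have h6 : Tendsto (fun n => ∫ η, 𝓕⁻ (p n) (A η) * 𝓕 ψ η) atTop
      (𝓝 (∫ η, g (A η) * 𝓕 ψ η)) := by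
    refine tendsto_integral_of_dominated_convergence (fun η => C * ‖𝓕 ψ η‖)
      (fun n => ((h4 n).comp A.continuous).aestronglyMeasurable.mul hψF.1)
      (hψF.norm.const_mul C) (fun n => Eventually.of_forall fun η => ?_)
      (Eventually.of_forall fun η => (hlim (A η)).mul_const _)
    rw [norm_mul]
    exact mul_le_mul_of_nonneg_right (hpC n _) (norm_nonneg _)
  exact ge_of_tendsto' h6 h3

/-- A modulated Gaussian is the Fourier transform of a nonnegative function, namely of its own
inverse transform. -/
theorem IsPositiveDefiniteLimit.integral_comp_mul_gaussian_nonneg {g : V → ℂ}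
    (hg : IsPositiveDefiniteLimit g) (A : W →L[ℝ] V) {a : ℝ} (ha : 0 < a) (s : W) :
    0 ≤ ∫ η, g (A η) * Complex.exp (-(a : ℂ) * ‖η‖ ^ 2 +
      2 * π * Complex.I * (inner ℝ s η : ℝ)) := by
  have hGi := integrable_gaussian_modulated ha s
  have hGc := continuous_gaussian_modulated a s
  have hFi := integrable_fourier_gaussian ha s
  have hF0 := fourier_gaussian_nonneg ha s
  set G : W → ℂ := fun v => Complex.exp (-(a : ℂ) * ‖v‖ ^ 2 +
      2 * π * Complex.I * (inner ℝ s v : ℝ))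
  have hinv : 𝓕 (𝓕⁻ G) = G := hGc.fourier_fourierInv_eq hGi hFi
  have h5 : 𝓕⁻ G = fun x => 𝓕 G (-x) := funext fun x => fourierInv_eq_fourier_neg _ _
  have hFc : Continuous (𝓕 G) :=
    VectorFourier.fourierIntegral_continuous continuous_fourierChar
      (by exact continuous_inner) hGi
  have := hg.integral_comp_mul_fourier_nonneg A (ψ := 𝓕⁻ G) (by rw [h5]; exact hFi.comp_neg)
    (by rw [h5]; exact hFc.comp continuous_neg) (by rw [hinv]; exact hGi)
    (fun x => by rw [h5]; exact hF0 _)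
  rwa [hinv] at this

end PositiveDefinite

/-! ### Growth and integrability for pointed cones -/

section TubeIntegrability

open Filter Topology

variable {d : ℕ} {f : MvPolynomial (Fin d) ℝ} {τ θ : EuclideanSpace ℝ (Fin d)}

/-- Factorization of a hyperbolic polynomial along a complex line through a point of the cone. -/
theorem IsHyperbolicAt.exists_factorization (h : IsHyperbolicAt f τ)
    (hθ : θ ∈ hyperbolicityCone f τ) (u : EuclideanSpace ℝ (Fin d)) :
    ∃ Λ : Multiset ℝ, ∀ z : ℂ,
      MvPolynomial.aeval (fun j => (θ j : ℂ) + z * (u j : ℂ)) f =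
        (MvPolynomial.eval θ f : ℂ) * (Λ.map fun l : ℝ => 1 + z * (l : ℂ)).prod := by
  obtain ⟨p, hf, -, -⟩ := id h
  have hst := h.stableAt_of_mem hθ
  obtain ⟨q, hq, hθ0, hr⟩ := hst.isHyperbolicAt hf
  set P := lineOver f (u : Fin d → ℝ) θ with hP
  have hdeg : P.natDegree = q := lineOver_natDegree_eq hq hθ0
  have hs : P.Splits := Polynomial.splits_iff_card_roots.2 ((hr u).trans hdeg.symm)
  have hcard : P.roots.card = q := hr u
  have hlead : P.leadingCoeff = MvPolynomial.eval θ f := by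
    rw [Polynomial.leadingCoeff, hdeg]
    exact (hq.lineOver_natDegree_le_and_coeff (u : Fin d → ℝ) θ).2
  -- Homogeneity gives f(θ + zu) = z^q P(1/z), so a root r of P contributes the factor 1 - zr.
  refine ⟨P.roots.map Neg.neg, fun z => ?_⟩
  rcases eq_or_ne z 0 with rfl | hz
  · simp [aeval_ofReal]
  have h1 : (fun j => (θ j : ℂ) + z * (u j : ℂ)) =
      fun j => z * ((u j : ℂ) + z⁻¹ * (θ j : ℂ)) := by
    funext j
    field_simp
    ring
  have h2 : MvPolynomial.aeval (fun j => (u j : ℂ) + z⁻¹ * (θ j : ℂ)) f =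
      (MvPolynomial.eval θ f : ℂ) * (P.roots.map fun l : ℝ => z⁻¹ - (l : ℂ)).prod := by
    rw [← lineOver_eval, ← lineOver_map, (hs.map _).eval_eq_prod_roots, hs.roots_map,
      Polynomial.leadingCoeff_map, hlead, Multiset.map_map]
    rfl
  rw [h1, hq.aeval_mul, h2, mul_left_comm, ← hcard, Multiset.map_map]
  congr 1
  generalize P.roots = s
  induction s using Multiset.induction_on with
  | empty => simp
  | cons a s ih =>
    simp only [Multiset.card_cons, Multiset.map_cons, Multiset.prod_cons, pow_succ'] at ih ⊢
    rw [← ih]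
    simp only [Function.comp_apply, Complex.ofReal_neg]
    field_simp
    ring

/-- Expanding the product, the discarded cross terms are nonnegative. This supplies the quadratic
growth in R. -/
theorem Multiset.one_add_mul_sum_sq_le_prod (Λ : Multiset ℝ) (R : ℝ) :
    1 + R ^ 2 * (Λ.map fun l => l ^ 2).sum ≤ (Λ.map fun l => 1 + R ^ 2 * l ^ 2).prod := by
  induction Λ using Multiset.induction_on with
  | empty => simp
  | cons a s ih =>
    simp only [Multiset.map_cons, Multiset.sum_cons, Multiset.prod_cons]
    have h1 : 0 ≤ (s.map fun l => l ^ 2).sum := Multiset.sum_nonneg (by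
      intro x hx
      obtain ⟨l, -, rfl⟩ := Multiset.mem_map.1 hx
      positivity)
    have h2 : 0 ≤ R ^ 2 * a ^ 2 := by positivity
    have h3 : 0 ≤ R ^ 2 * (s.map fun l => l ^ 2).sum := by positivity
    nlinarith [mul_le_mul_of_nonneg_left ih (by linarith : 0 ≤ 1 + R ^ 2 * a ^ 2),
      mul_nonneg h2 h3]

/-- Factorwise 1 + x ≤ eˣ. It converts a lower bound for |f|² on the unit sphere into one for the
sum of squares of the factors' coefficients. -/
theorem Multiset.prod_one_add_sq_le_exp (Λ : Multiset ℝ) :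
    (Λ.map fun l => 1 + l ^ 2).prod ≤ Real.exp (Λ.map fun l => l ^ 2).sum := by
  induction Λ using Multiset.induction_on with
  | empty => simp
  | cons a s ih =>
    simp only [Multiset.map_cons, Multiset.sum_cons, Multiset.prod_cons, Real.exp_add]
    have h1 : 0 ≤ (s.map fun l => 1 + l ^ 2).prod := Multiset.prod_nonneg (by
      intro x hx
      obtain ⟨l, -, rfl⟩ := Multiset.mem_map.1 hx
      positivity)
    refine mul_le_mul ?_ ih h1 (Real.exp_nonneg _)
    rw [add_comm]
    exact Real.add_one_le_exp _

theorem norm_sq_prod_one_add_I_mul (Λ : Multiset ℝ) (R : ℝ) :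
    ‖(Λ.map fun l : ℝ => 1 + (Complex.I * (R : ℂ)) * (l : ℂ)).prod‖ ^ 2 =
      (Λ.map fun l => 1 + R ^ 2 * l ^ 2).prod := by
  induction Λ using Multiset.induction_on with
  | empty => simp
  | cons a s ih =>
    simp only [Multiset.map_cons, Multiset.prod_cons, norm_mul, mul_pow, ih]
    congr 1
    rw [Complex.sq_norm, Complex.normSq_apply]
    simp
    ring

theorem smul_mem_hyperbolicityCone (h : IsHyperbolicAt f τ) (hθ : θ ∈ hyperbolicityCone f τ)
    {r : ℝ} (hr : 0 < r) : r • θ ∈ hyperbolicityCone f τ := by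
  obtain ⟨p, hf, -, -⟩ := id h
  rw [← hyperbolicityCone_eq_of_mem hθ]
  have hpre : IsPreconnected ((fun r : ℝ => r • θ) '' Set.Ioi 0) :=
    isPreconnected_Ioi.image _ (by fun_prop)
  refine hpre.subset_connectedComponentIn (x := θ) ⟨1, by simp, by simp⟩ ?_ ⟨r, hr, rfl⟩
  rintro _ ⟨s, hs, rfl⟩
  change MvPolynomial.eval (s • θ) f ≠ 0
  rw [hf.eval_smul_euclidean]
  exact mul_ne_zero (pow_ne_zero _ (ne_of_gt hs)) (eval_ne_zero_of_mem_hyperbolicityCone hθ)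

/-- In a direction not contained in the lineality space, the modulus grows off the cone. -/
theorem lt_norm_tubeEval (h : IsHyperbolicAt f τ) (hτ : 0 < MvPolynomial.eval τ f)
    (hC : HasPointedCone f τ) (hθ : θ ∈ hyperbolicityCone f τ)
    {u : EuclideanSpace ℝ (Fin d)} (hu : u ≠ 0) :
    MvPolynomial.eval θ f ^ 2 < ‖tubeEval f θ u‖ ^ 2 := by
  have hc := eval_pos_of_mem_hyperbolicityCone hτ hθ
  obtain ⟨Λ, hΛ⟩ := h.exists_factorization hθ u
  have h1 : ‖tubeEval f θ u‖ ^ 2 =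
      MvPolynomial.eval θ f ^ 2 * (Λ.map fun l => 1 + l ^ 2).prod := by
    have := norm_sq_prod_one_add_I_mul Λ 1
    simp only [Complex.ofReal_one, mul_one, one_pow, one_mul] at this
    rw [tubeEval, hΛ, norm_mul, mul_pow, this, Complex.norm_real, Real.norm_eq_abs, sq_abs]
  rw [h1]
  by_contra hle
  have h2 : (Λ.map fun l => 1 + l ^ 2).prod ≤ 1 := by
    by_contra h3
    exact hle (lt_mul_of_one_lt_right (by positivity) (not_le.1 h3))
  have h3 := Multiset.one_add_mul_sum_sq_le_prod Λ 1
  simp only [one_pow, one_mul] at h3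
  have h4 : ∀ l ∈ Λ, l = 0 := by
    intro l hl
    have h5 : l ^ 2 ≤ (Λ.map fun l => l ^ 2).sum :=
      Multiset.single_le_sum (by
        intro x hx
        obtain ⟨l, -, rfl⟩ := Multiset.mem_map.1 hx
        positivity) _ (Multiset.mem_map_of_mem _ hl)
    exact pow_eq_zero_iff (two_ne_zero) |>.1 (le_antisymm (by linarith) (sq_nonneg l))
  -- With all coefficients zero, f is constant on the line θ + ℝu, which therefore stays in the
  -- cone. Scaling down its far points places both u and -u in the closure, against pointedness.
  have hline : ∀ s : ℝ, θ + s • u ∈ hyperbolicityCone f τ := by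
    intro s
    have hpre : IsPreconnected (Set.range fun s : ℝ => θ + s • u) :=
      isPreconnected_range (by fun_prop)
    rw [← hyperbolicityCone_eq_of_mem hθ]
    refine hpre.subset_connectedComponentIn (x := θ) ⟨0, by simp⟩ ?_ ⟨s, rfl⟩
    rintro _ ⟨s, rfl⟩
    have h6 := hΛ s
    rw [Multiset.map_congr rfl (g := fun _ => (1 : ℂ)) (fun l hl => by simp [h4 l hl])] at h6
    have h7 : (fun j => (θ j : ℂ) + (s : ℂ) * (u j : ℂ)) =
        fun j => (((θ + s • u) j : ℝ) : ℂ) := by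
      funext j; simp
    rw [h7, aeval_ofReal] at h6
    simp only [Multiset.map_const', Multiset.prod_replicate, one_pow, mul_one] at h6
    change MvPolynomial.eval (θ + s • u) f ≠ 0
    rw [Complex.ofReal_inj.1 h6]
    exact hc.ne'
  have hcl : ∀ ε : ℝ, ε ^ 2 = 1 → ε • u ∈ closure (hyperbolicityCone f τ) := by
    intro ε hε
    have hlim : Tendsto (fun t : ℝ => ε • u + t • θ) (𝓝[>] 0) (𝓝 (ε • u)) := by
      have hcont : Continuous fun t : ℝ => ε • u + t • θ := by fun_prop
      simpa using (hcont.tendsto 0).mono_left (nhdsWithin_le_nhds (s := Set.Ioi 0))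
    refine mem_closure_of_tendsto hlim (eventually_nhdsWithin_of_forall fun t ht => ?_)
    have := smul_mem_hyperbolicityCone h (hline (t⁻¹ * ε)) ht
    rw [smul_add, smul_smul, mul_inv_cancel_left₀ (ne_of_gt ht), add_comm] at this
    exact this
  exact hu (hC u (by simpa using hcl 1 (by norm_num)) (by simpa using hcl (-1) (by norm_num)))

theorem integrable_tubeNegPow (h : IsHyperbolicAt f τ) (hτ : 0 < MvPolynomial.eval τ f)
    (hC : HasPointedCone f τ) (hθ : θ ∈ hyperbolicityCone f τ) {α : ℝ} (hα : (d : ℝ) < α) :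
    Integrable (tubeNegPow f α θ) := by
  have hα0 : 0 < α := (Nat.cast_nonneg d).trans_lt hα
  have hc := eval_pos_of_mem_hyperbolicityCone hτ hθ
  set c := MvPolynomial.eval θ f
  have hcontθ : Continuous (tubeEval f θ) :=
    (continuous_tubeEval f).comp (f := fun η => (θ, η)) (by fun_prop)
  have hpos : ∀ η, 0 < ‖tubeEval f θ η‖ ^ 2 / c ^ 2 := fun η =>
    div_pos (pow_pos (norm_pos_iff.2 (h.tubeEval_ne_zero hθ η)) 2) (by positivity)
  -- Compactness of the unit sphere makes the strict inequality uniform. The logarithm is taken so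
  -- that δ bounds the sum of squares directly.
  obtain ⟨δ, hδ, hmin⟩ := (isCompact_sphere (0 : EuclideanSpace ℝ (Fin d)) 1).exists_forall_le'
    (f := fun u => Real.log (‖tubeEval f θ u‖ ^ 2 / c ^ 2))
    (Continuous.log (by fun_prop) fun η => (hpos η).ne').continuousOn (a := 0) (fun u hu => by
      refine Real.log_pos ((one_lt_div (by positivity)).2 (lt_norm_tubeEval h hτ hC hθ ?_))
      rintro rfl
      simp at hu)
  have hgrow : ∀ η, c ^ 2 * (1 + δ * ‖η‖ ^ 2) ≤ ‖tubeEval f θ η‖ ^ 2 := by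
    intro η
    rcases eq_or_ne η 0 with rfl | hη
    · simp only [norm_zero, tubeEval_zero, Complex.norm_real]
      simp [c]
    have hη' : ‖η‖ ≠ 0 := norm_ne_zero_iff.2 hη
    set u := ‖η‖⁻¹ • η with hu
    have hηu : η = ‖η‖ • u := by rw [hu, smul_smul, mul_inv_cancel₀ hη', one_smul]
    have hu1 : u ∈ Metric.sphere (0 : EuclideanSpace ℝ (Fin d)) 1 := by
      rw [mem_sphere_zero_iff_norm, hu, norm_smul, norm_inv, norm_norm, inv_mul_cancel₀ hη']
    obtain ⟨Λ, hΛ⟩ := h.exists_factorization hθ u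
    have hval : ∀ R : ℝ, ‖tubeEval f θ (R • u)‖ ^ 2 =
        c ^ 2 * (Λ.map fun l => 1 + R ^ 2 * l ^ 2).prod := by
      intro R
      rw [← norm_sq_prod_one_add_I_mul, tubeEval]
      have h7 : (fun j => (θ j : ℂ) + Complex.I * (((R • u) j : ℝ) : ℂ)) =
          fun j => (θ j : ℂ) + (Complex.I * (R : ℂ)) * (u j : ℂ) := by
        funext j
        simp only [PiLp.smul_apply, smul_eq_mul, Complex.ofReal_mul]
        ring
      rw [h7, hΛ, norm_mul, mul_pow, Complex.norm_real, Real.norm_eq_abs, sq_abs]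
    have h1 : δ ≤ (Λ.map fun l => l ^ 2).sum := by
      have h2 := hval 1
      simp only [one_smul, one_pow, one_mul] at h2
      have h3 := hmin u hu1
      rw [h2, mul_div_cancel_left₀ _ (by positivity)] at h3
      have h4 := hpos u
      rw [h2, mul_div_cancel_left₀ _ (by positivity)] at h4
      exact h3.trans ((Real.log_le_iff_le_exp h4).2 (Multiset.prod_one_add_sq_le_exp Λ))
    conv_rhs => rw [hηu]
    rw [hval]
    refine mul_le_mul_of_nonneg_left ?_ (by positivity)
    have h5 := Multiset.one_add_mul_sum_sq_le_prod Λ ‖η‖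
    have h6 := mul_le_mul_of_nonneg_left h1 (sq_nonneg ‖η‖)
    linarith
  set m := c ^ 2 * min δ 1 with hm
  have hm0 : 0 < m := by positivity
  have hint : Integrable fun η : EuclideanSpace ℝ (Fin d) =>
      m ^ (-α / 2) * (1 + ‖η‖ ^ 2) ^ (-α / 2) :=
    (integrable_rpow_neg_one_add_norm_sq (by simpa using hα)).const_mul _
  refine hint.mono' (continuous_tubeNegPow h hτ hθ α).aestronglyMeasurable
    (Eventually.of_forall fun η => ?_)
  have h8 : m * (1 + ‖η‖ ^ 2) ≤ ‖tubeEval f θ η‖ ^ 2 := by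
    refine le_trans ?_ (hgrow η)
    rw [hm, mul_assoc]
    refine mul_le_mul_of_nonneg_left ?_ (by positivity)
    nlinarith [min_le_left δ 1, min_le_right δ 1, sq_nonneg ‖η‖]
  rw [norm_tubeNegPow h hτ hθ, ← Real.mul_rpow hm0.le (by positivity)]
  calc ‖tubeEval f θ η‖ ^ (-α) = (‖tubeEval f θ η‖ ^ 2) ^ (-α / 2) := by
        rw [← Real.rpow_natCast, ← Real.rpow_mul (norm_nonneg _)]
        congr 1
        push_cast
        ring
    _ ≤ (m * (1 + ‖η‖ ^ 2)) ^ (-α / 2) :=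
        Real.rpow_le_rpow_of_nonpos (by positivity) h8 (by linarith)

end TubeIntegrability

/-! ### Restriction to the subspace -/

section Restriction

variable {d c : ℕ} {f : MvPolynomial (Fin d) ℝ} {L : Submodule ℝ (EuclideanSpace ℝ (Fin d))}

/-- The parametrization `t ↦ t₁ b₁ + ⋯ + t_c b_c` of `L`. -/
def basisMap (b : Module.Basis (Fin c) ℝ L) :
    EuclideanSpace ℝ (Fin c) →L[ℝ] EuclideanSpace ℝ (Fin d) :=
  LinearMap.toContinuousLinearMap
    (L.subtype ∘ₗ b.equivFun.symm.toLinearMap ∘ₗ (WithLp.linearEquiv 2 ℝ (Fin c → ℝ)).toLinearMap)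

theorem basisMap_eq (b : Module.Basis (Fin c) ℝ L) (t : EuclideanSpace ℝ (Fin c)) :
    basisMap b t = (b.equivFun.symm t.ofLp : EuclideanSpace ℝ (Fin d)) := rfl

theorem basisMap_apply (b : Module.Basis (Fin c) ℝ L) (t : EuclideanSpace ℝ (Fin c)) (j : Fin d) :
    basisMap b t j = ∑ i, (b i : EuclideanSpace ℝ (Fin d)) j * t i := by
  rw [basisMap_eq, Module.Basis.equivFun_symm_apply]
  simp [mul_comm]

theorem basisMap_basisCoords (b : Module.Basis (Fin c) ℝ L) (e : L) :
    basisMap b (basisCoords b e) = e := by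
  rw [basisMap_eq, basisCoords, LinearEquiv.symm_apply_apply]

theorem basisMap_injective (b : Module.Basis (Fin c) ℝ L) : Function.Injective (basisMap b) :=
  Subtype.val_injective.comp (b.equivFun.symm.injective.comp (WithLp.ofLp_injective 2))

theorem aeval_restrictPolynomial {K : Type*} [CommRing K] [Algebra ℝ K]
    (f : MvPolynomial (Fin d) ℝ) (b : Module.Basis (Fin c) ℝ L) (z : Fin c → K) :
    MvPolynomial.aeval z (restrictPolynomial f b) = MvPolynomial.aeval
      (fun j => ∑ i, algebraMap ℝ K ((b i : EuclideanSpace ℝ (Fin d)) j) * z i) f := by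
  rw [restrictPolynomial, MvPolynomial.comp_aeval_apply]
  simp

theorem tubeEval_restrictPolynomial (f : MvPolynomial (Fin d) ℝ) (b : Module.Basis (Fin c) ℝ L)
    (ρ η : EuclideanSpace ℝ (Fin c)) :
    tubeEval (restrictPolynomial f b) ρ η = tubeEval f (basisMap b ρ) (basisMap b η) := by
  rw [tubeEval, aeval_restrictPolynomial, tubeEval]
  congr 2
  funext j
  rw [basisMap_apply, basisMap_apply]
  push_cast
  rw [Finset.mul_sum, ← Finset.sum_add_distrib]
  refine Finset.sum_congr rfl fun i _ => ?_
  simp only [Complex.coe_algebraMap]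
  ring

theorem eval_restrictPolynomial (f : MvPolynomial (Fin d) ℝ) (b : Module.Basis (Fin c) ℝ L)
    (ρ : EuclideanSpace ℝ (Fin c)) :
    MvPolynomial.eval ρ (restrictPolynomial f b) = MvPolynomial.eval (basisMap b ρ) f := by
  have h := aeval_restrictPolynomial (K := ℝ) f b ρ.ofLp
  refine h.trans ?_
  change MvPolynomial.eval _ f = _
  congr 2
  funext j
  rw [basisMap_apply]
  rfl

/-- The branches agree as well as the values, because the logarithm is an integral along a segment
and the parametrization is linear. -/
theorem tubeNegPow_restrictPolynomial (f : MvPolynomial (Fin d) ℝ)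
    (b : Module.Basis (Fin c) ℝ L) (α : ℝ) (ρ η : EuclideanSpace ℝ (Fin c)) :
    tubeNegPow (restrictPolynomial f b) α ρ η = tubeNegPow f α (basisMap b ρ) (basisMap b η) := by
  simp only [tubeNegPow, tubeLog, tubeEval_restrictPolynomial, eval_restrictPolynomial, map_smul]

theorem linePolynomial_restrictPolynomial (f : MvPolynomial (Fin d) ℝ)
    (b : Module.Basis (Fin c) ℝ L) (τ x : EuclideanSpace ℝ (Fin c)) :
    linePolynomial (restrictPolynomial f b) τ x =
      linePolynomial f (basisMap b τ) (basisMap b x) := by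
  rw [linePolynomial, aeval_restrictPolynomial, linePolynomial]
  congr 2
  funext j
  rw [basisMap_apply, basisMap_apply, map_sum, map_sum, Finset.sum_mul, ← Finset.sum_add_distrib]
  refine Finset.sum_congr rfl fun i _ => ?_
  simp only [Polynomial.algebraMap_eq, map_mul]
  ring

theorem isHyperbolicAt_restrictPolynomial {b : Module.Basis (Fin c) ℝ L}
    {τ : EuclideanSpace ℝ (Fin c)} (h : IsHyperbolicAt f (basisMap b τ)) :
    IsHyperbolicAt (restrictPolynomial f b) τ := by
  obtain ⟨p, hf, h0, hr⟩ := h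
  refine ⟨p, ?_, by rwa [eval_restrictPolynomial], fun x => by
    rw [linePolynomial_restrictPolynomial]; exact hr _⟩
  have := hf.aeval (fun j => ∑ i : Fin c,
      MvPolynomial.C ((b i : EuclideanSpace ℝ (Fin d)) j) * MvPolynomial.X i) (n := 1) fun j =>
    MvPolynomial.IsHomogeneous.sum _ _ _ fun i _ => by
      simpa using (MvPolynomial.isHomogeneous_C (Fin c)
        ((b i : EuclideanSpace ℝ (Fin d)) j)).mul (MvPolynomial.isHomogeneous_X ℝ i)
  rwa [one_mul] at this

/-- The image of the restricted cone is connected, avoids the zeros of f and contains the image of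
e. -/
theorem basisMap_mem_hyperbolicityCone {b : Module.Basis (Fin c) ℝ L}
    {τ : EuclideanSpace ℝ (Fin d)} {e ρ : EuclideanSpace ℝ (Fin c)}
    (he : basisMap b e ∈ hyperbolicityCone f τ)
    (hρ : ρ ∈ hyperbolicityCone (restrictPolynomial f b) e) :
    basisMap b ρ ∈ hyperbolicityCone f τ := by
  have hpre : IsPreconnected (hyperbolicityCone (restrictPolynomial f b) e) :=
    isPreconnected_connectedComponentIn
  have he0 : e ∈ hyperbolicityCone (restrictPolynomial f b) e :=
    mem_connectedComponentIn (by
      change MvPolynomial.eval e (restrictPolynomial f b) ≠ 0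
      rw [eval_restrictPolynomial]
      exact eval_ne_zero_of_mem_hyperbolicityCone he)
  rw [← hyperbolicityCone_eq_of_mem he]
  refine (hpre.image (basisMap b) (basisMap b).continuous.continuousOn).subset_connectedComponentIn
    ⟨e, he0, rfl⟩ ?_ ⟨ρ, hρ, rfl⟩
  rintro _ ⟨t, ht, rfl⟩
  have := eval_ne_zero_of_mem_hyperbolicityCone ht
  rwa [eval_restrictPolynomial] at this

theorem hasPointedCone_restrictPolynomial {b : Module.Basis (Fin c) ℝ L}
    {τ : EuclideanSpace ℝ (Fin d)} {e : EuclideanSpace ℝ (Fin c)} (h : HasPointedCone f τ)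
    (he : basisMap b e ∈ hyperbolicityCone f τ) :
    HasPointedCone (restrictPolynomial f b) e := by
  have hmem : ∀ v ∈ closure (hyperbolicityCone (restrictPolynomial f b) e),
      basisMap b v ∈ closure (hyperbolicityCone f τ) := fun v hv =>
    map_mem_closure (basisMap b).continuous hv fun ρ hρ => basisMap_mem_hyperbolicityCone he hρ
  intro v hv hv'
  have h2 := hmem _ hv'
  rw [map_neg] at h2
  exact basisMap_injective b ((h _ (hmem v hv) h2).trans (map_zero _).symm)

end Restriction

/-! ### Riesz kernels and positive definiteness -/

section RieszKernels

open Filter Topology Real FourierTransform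
open scoped ComplexOrder

variable {d c : ℕ} {f : MvPolynomial (Fin d) ℝ} {τ θ : EuclideanSpace ℝ (Fin d)} {α : ℝ}

theorem Complex.nonneg_of_ofReal_mul {r : ℝ} (hr : 0 < r) {z : ℂ} (h : 0 ≤ (r : ℂ) * z) :
    0 ≤ z := by
  rw [Complex.nonneg_iff, Complex.re_ofReal_mul, Complex.im_ofReal_mul] at h
  exact Complex.nonneg_iff.2 ⟨nonneg_of_mul_nonneg_right h.1 hr,
    ((mul_eq_zero_iff_left hr.ne').1 h.2.symm).symm⟩

/-- Positive definiteness of the boundary function propagates through the cone. -/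
theorem isPositiveDefiniteLimit_tubeNegPow (h : IsHyperbolicAt f τ)
    (hτ : 0 < MvPolynomial.eval τ f) (hα : 0 < α) (hθ : θ ∈ hyperbolicityCone f τ)
    (hpd : IsPositiveDefiniteLimit (tubeNegPow f α θ)) {θ' : EuclideanSpace ℝ (Fin d)}
    (hθ' : θ' ∈ hyperbolicityCone f τ) : IsPositiveDefiniteLimit (tubeNegPow f α θ') := by
  have hpi : (π : ℂ) ≠ 0 := by exact_mod_cast pi_ne_zero
  have hnonneg : ∀ a : ℝ, 0 < a → ∀ σ, 0 ≤ gaussianTubeIntegral f α a σ θ := by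
    intro a ha σ
    have h1 := hpd.integral_comp_mul_gaussian_nonneg (ContinuousLinearMap.id ℝ _) ha
      ((2 * π)⁻¹ • ((2 * a) • θ + σ))
    have h2 : gaussianTubeIntegral f α a σ θ = (Real.exp (a * ‖θ‖ ^ 2 + inner ℝ θ σ) : ℝ) *
        ∫ η, tubeNegPow f α θ (ContinuousLinearMap.id ℝ _ η) *
          Complex.exp (-(a : ℂ) * ‖η‖ ^ 2 + 2 * π * Complex.I *
            (inner ℝ ((2 * π)⁻¹ • ((2 * a) • θ + σ)) η : ℝ)) := by
      rw [gaussianTubeIntegral, ← integral_const_mul]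
      refine integral_congr_ae (Eventually.of_forall fun η => ?_)
      simp only [tubeGaussian_eq, ContinuousLinearMap.id_apply]
      rw [mul_left_comm, ← Complex.exp_add]
      congr 4
      rw [real_inner_smul_left, real_inner_comm]
      push_cast
      field_simp
    rw [h2]
    exact mul_nonneg (Complex.zero_le_real.2 (Real.exp_nonneg _)) h1
  have hk := integrable_gaussian_modulated one_pos (0 : EuclideanSpace ℝ (Fin d))
  have hkc := continuous_gaussian_modulated 1 (0 : EuclideanSpace ℝ (Fin d))
  simp only [inner_zero_left, Complex.ofReal_zero, mul_zero, add_zero] at hk hkc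
  refine IsPositiveDefiniteLimit.of_regularization (continuous_tubeNegPow h hτ hθ' α)
    (norm_tubeNegPow_le h hτ hθ' hα) hk hkc (B := 1) (fun x => ?_) (by simp) fun δ hδ s => ?_
  · rw [norm_gaussian_cexp]
    refine Real.exp_le_one_iff.2 ?_
    have := sq_nonneg ‖x‖
    linarith
  -- This σ cancels the term 2δ²θ' arising from the square of θ' + iη, leaving the pure frequency
  -- -2πs, so the integral is a positive multiple of the Fourier transform at s.
  · have h1 := hnonneg (δ ^ 2) (by positivity) ((-2 * π) • s - (2 * δ ^ 2) • θ')
    rw [← gaussianTubeIntegral_eq h hτ hα (by positivity) _ hθ hθ'] at h1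
    set σ := (-2 * π) • s - (2 * δ ^ 2) • θ' with hσ
    have h2 : gaussianTubeIntegral f α (δ ^ 2) σ θ' =
        (Real.exp (δ ^ 2 * ‖θ'‖ ^ 2 + inner ℝ θ' σ) : ℝ) *
        𝓕 (fun w => Complex.exp (-((1 : ℝ) : ℂ) * ‖δ • w‖ ^ 2) * tubeNegPow f α θ' w) s := by
      rw [gaussianTubeIntegral, fourier_eq', ← integral_const_mul]
      refine integral_congr_ae (Eventually.of_forall fun η => ?_)
      simp only [tubeGaussian_eq, smul_eq_mul]
      have h3 : (2 * δ ^ 2) • θ' + σ = (-2 * π) • s := by rw [hσ]; abel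
      rw [h3, real_inner_smul_right, norm_smul, Real.norm_of_nonneg hδ.le]
      push_cast
      ring_nf
    rw [h2] at h1
    exact Complex.nonneg_of_ofReal_mul (Real.exp_pos _) h1

theorem integral_cexp_inner_mul_eq_fourier (ψ : EuclideanSpace ℝ (Fin d) → ℂ)
    (η : EuclideanSpace ℝ (Fin d)) :
    ∫ σ, Complex.exp (Complex.I * (inner ℝ η σ : ℝ)) * ψ σ = 𝓕 ψ ((-(2 * π)⁻¹) • η) := by
  have hpi : (π : ℂ) ≠ 0 := by exact_mod_cast pi_ne_zero
  rw [fourier_eq']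
  refine integral_congr_ae (Eventually.of_forall fun σ => ?_)
  simp only [smul_eq_mul]
  congr 2
  rw [real_inner_smul_right, real_inner_comm]
  push_cast
  field_simp

theorem rieszDistribution_eq (f : MvPolynomial (Fin d) ℝ) (α : ℝ)
    (θ : EuclideanSpace ℝ (Fin d)) (φ : EuclideanSpace ℝ (Fin d) → ℝ) :
    rieszDistribution f α θ φ = (((2 * π) ^ d)⁻¹ : ℝ) * ∫ η, tubeNegPow f α θ η *
      𝓕 (fun σ => ((Real.exp (inner ℝ θ σ) * φ σ : ℝ) : ℂ)) ((-(2 * π)⁻¹) • η) := by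
  rw [rieszDistribution]
  congr 1
  refine integral_congr_ae (Eventually.of_forall fun η => ?_)
  simp only
  rw [← integral_cexp_inner_mul_eq_fourier, ← integral_const_mul]
  refine integral_congr_ae (Eventually.of_forall fun σ => ?_)
  simp only [rieszIntegrand, Complex.exp_add]
  push_cast
  ring

theorem integrable_fourier_of_contDiff {ψ : EuclideanSpace ℝ (Fin d) → ℝ}
    (h1 : ContDiff ℝ (⊤ : ℕ∞) ψ) (h2 : HasCompactSupport ψ) :
    Integrable (𝓕 fun σ => (ψ σ : ℂ)) := by
  have h3 : HasCompactSupport fun σ => (ψ σ : ℂ) := h2.comp_left (g := Complex.ofReal) rfl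
  have h4 : ContDiff ℝ (⊤ : ℕ∞) fun σ => (ψ σ : ℂ) := Complex.ofRealCLM.contDiff.comp h1
  exact (𝓕 (h3.toSchwartzMap h4)).integrable

/-- A nonnegative Riesz distribution has a positive definite boundary function. -/
theorem RieszDistributionNonneg.isPositiveDefiniteLimit (h : IsHyperbolicAt f τ)
    (hτ : 0 < MvPolynomial.eval τ f) (hα : 0 < α) (hθ : θ ∈ hyperbolicityCone f τ)
    (hR : RieszDistributionNonneg f α θ) : IsPositiveDefiniteLimit (tubeNegPow f α θ) := by
  let B : ContDiffBump (0 : EuclideanSpace ℝ (Fin d)) := ⟨1, 2, one_pos, one_lt_two⟩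
  set ψ : EuclideanSpace ℝ (Fin d) → ℝ := B.normed volume with hψ
  have hψs : ContDiff ℝ (⊤ : ℕ∞) ψ := B.contDiff_normed
  have hψc : HasCompactSupport ψ := B.hasCompactSupport_normed
  have hψ0 : ∀ x, 0 ≤ ψ x := B.nonneg_normed
  have hψi : Integrable fun σ => (ψ σ : ℂ) :=
    (hψs.continuous.integrable_of_hasCompactSupport hψc).ofReal
  have hFi := integrable_fourier_of_contDiff hψs hψc
  have hFc : Continuous (𝓕 fun σ => (ψ σ : ℂ)) :=
    VectorFourier.fourierIntegral_continuous continuous_fourierChar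
      (by exact continuous_inner) hψi
  -- The regularizer is the transform of a normalized bump, so its value at 0 is 1 and the
  -- regularized transforms become pairings with test functions.
  refine IsPositiveDefiniteLimit.of_regularization
    (k := fun η => 𝓕 (fun σ => (ψ σ : ℂ)) ((-(2 * π)⁻¹) • η))
    (continuous_tubeNegPow h hτ hθ α)
    (norm_tubeNegPow_le h hτ hθ hα) (hFi.comp_smul (by simp [pi_ne_zero]))
    (hFc.comp (by fun_prop)) (B := ∫ σ, ‖(ψ σ : ℂ)‖)
    (fun x => VectorFourier.norm_fourierIntegral_le_integral_norm _ _ _ _ _) ?_ fun δ hδ s => ?_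
  · rw [smul_zero, fourier_eq']
    simp only [inner_zero_right, mul_zero, Complex.ofReal_zero, zero_mul, Complex.exp_zero,
      one_smul]
    rw [integral_complex_ofReal, B.integral_normed, Complex.ofReal_one]
  -- The exponential cancels e^⟨θ,σ⟩ in the kernel; the translation by 2πs produces the frequency s
  -- and the dilation by δ produces k(δη).
  · set φ : EuclideanSpace ℝ (Fin d) → ℝ := fun σ =>
      Real.exp (-inner ℝ θ σ) * ψ (δ⁻¹ • (σ + (2 * π) • s)) with hφ
    have hφ1 : ContDiff ℝ (⊤ : ℕ∞) φ := by
      have hin : ContDiff ℝ (⊤ : ℕ∞) fun σ : EuclideanSpace ℝ (Fin d) => inner ℝ θ σ :=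
        (innerSL ℝ θ).contDiff
      exact hin.neg.exp.mul (hψs.comp (by fun_prop))
    have hφ2 : HasCompactSupport φ := by
      refine HasCompactSupport.mul_left ?_
      have := (hψc.comp_homeomorph (Homeomorph.smulOfNeZero δ⁻¹ (inv_ne_zero hδ.ne'))).comp_homeomorph
        (Homeomorph.addRight ((2 * π) • s))
      exact this
    have hφ3 : ∀ σ, 0 ≤ φ σ := fun σ => mul_nonneg (Real.exp_nonneg _) (hψ0 _)
    have h1 : 0 ≤ rieszDistribution f α θ φ := by
      have := hR φ hφ1 hφ2 hφ3
      exact Complex.nonneg_iff.2 ⟨this.2, this.1.symm⟩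
    have h2 : ∀ η, 𝓕 (fun σ => ((Real.exp (inner ℝ θ σ) * φ σ : ℝ) : ℂ)) ((-(2 * π)⁻¹) • η) =
        ((δ ^ d : ℝ) : ℂ) * (Complex.exp (((-2 * π * inner ℝ η s : ℝ) : ℂ) * Complex.I) *
          𝓕 (fun σ => (ψ σ : ℂ)) ((-(2 * π)⁻¹) • (δ • η))) := by
      intro η
      rw [← integral_cexp_inner_mul_eq_fourier, ← integral_cexp_inner_mul_eq_fourier,
        ← integral_const_mul]
      set K : EuclideanSpace ℝ (Fin d) → ℂ := fun u =>
        Complex.exp (((-2 * π * inner ℝ η s : ℝ) : ℂ) * Complex.I) *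
          (Complex.exp (Complex.I * (inner ℝ (δ • η) u : ℝ)) * (ψ u : ℂ)) with hK
      have h3 : ∀ σ, Complex.exp (Complex.I * (inner ℝ η σ : ℝ)) *
          ((Real.exp (inner ℝ θ σ) * φ σ : ℝ) : ℂ) = K (δ⁻¹ • (σ + (2 * π) • s)) := by
        intro σ
        have hδ' : (δ : ℂ) ≠ 0 := by exact_mod_cast hδ.ne'
        simp only [hK, hφ]
        rw [← mul_assoc (Real.exp _), ← Real.exp_add, add_neg_cancel, Real.exp_zero, one_mul,
          ← mul_assoc, ← Complex.exp_add]
        congr 2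
        rw [real_inner_smul_left, real_inner_smul_right, inner_add_right, real_inner_smul_right]
        push_cast
        field_simp
        ring
      simp only [h3]
      rw [integral_add_right_eq_self (fun σ => K (δ⁻¹ • σ)), Measure.integral_comp_inv_smul,
        finrank_euclideanSpace_fin, abs_of_pos (by positivity), Complex.real_smul]
    rw [rieszDistribution_eq] at h1
    simp only [h2] at h1
    have h4 : (∫ η, tubeNegPow f α θ η * (((δ ^ d : ℝ) : ℂ) *
        (Complex.exp (((-2 * π * inner ℝ η s : ℝ) : ℂ) * Complex.I) *
          𝓕 (fun σ => (ψ σ : ℂ)) ((-(2 * π)⁻¹) • (δ • η))))) = ((δ ^ d : ℝ) : ℂ) *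
        𝓕 (fun w => 𝓕 (fun σ => (ψ σ : ℂ)) ((-(2 * π)⁻¹) • (δ • w)) * tubeNegPow f α θ w) s := by
      rw [fourier_eq' _ s, ← integral_const_mul]
      refine integral_congr_ae (Eventually.of_forall fun η => ?_)
      simp only [smul_eq_mul]
      ring
    rw [h4] at h1
    have h5 := Complex.nonneg_of_ofReal_mul (by positivity) h1
    exact Complex.nonneg_of_ofReal_mul (by positivity) h5

/-- The distribution pairs g ∘ A with the transform of the nonnegative function e^⟨ρ,σ⟩φ(σ). The
factor -2π absorbed into A matches the two normalizations of the Fourier transform. -/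
theorem IsPositiveDefiniteLimit.rieszDistributionNonneg {F : MvPolynomial (Fin c) ℝ}
    {ρ : EuclideanSpace ℝ (Fin c)} {g : EuclideanSpace ℝ (Fin d) → ℂ}
    (hg : IsPositiveDefiniteLimit g)
    (A : EuclideanSpace ℝ (Fin c) →L[ℝ] EuclideanSpace ℝ (Fin d))
    (hF : ∀ η, tubeNegPow F α ρ η = g (A η)) : RieszDistributionNonneg F α ρ := by
  intro φ h1 h2 h3
  set ψ : EuclideanSpace ℝ (Fin c) → ℝ := fun σ => Real.exp (inner ℝ ρ σ) * φ σ with hψ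
  have hψs : ContDiff ℝ (⊤ : ℕ∞) ψ := (innerSL ℝ ρ).contDiff.exp.mul h1
  have hψc : HasCompactSupport ψ := h2.mul_left
  have hψi : Integrable fun σ => (ψ σ : ℂ) :=
    (hψs.continuous.integrable_of_hasCompactSupport hψc).ofReal
  have hpos := hg.integral_comp_mul_fourier_nonneg ((-(2 * π)) • A) (ψ := fun σ => (ψ σ : ℂ)) hψi
    (Complex.continuous_ofReal.comp hψs.continuous) (integrable_fourier_of_contDiff hψs hψc)
    fun x => Complex.zero_le_real.2 (mul_nonneg (Real.exp_nonneg _) (h3 x))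
  have key : 0 ≤ rieszDistribution F α ρ φ := by
    rw [rieszDistribution_eq]
    refine mul_nonneg (Complex.zero_le_real.2 (by positivity)) ?_
    have h4 : ∀ η : EuclideanSpace ℝ (Fin c), tubeNegPow F α ρ η *
        𝓕 (fun σ => ((Real.exp (inner ℝ ρ σ) * φ σ : ℝ) : ℂ)) ((-(2 * π)⁻¹) • η) =
        (fun w => g (((-(2 * π)) • A) w) * 𝓕 (fun σ => (ψ σ : ℂ)) w) ((-(2 * π)⁻¹) • η) := by
      intro η
      simp only [hF, smul_apply, map_smul, smul_smul]
      rw [neg_mul_neg, inv_mul_cancel₀ (by positivity : 2 * π ≠ 0), one_smul]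
    rw [funext h4, Measure.integral_comp_smul volume
      (fun w => g (((-(2 * π)) • A) w) * 𝓕 (fun σ => (ψ σ : ℂ)) w), Complex.real_smul]
    exact mul_nonneg (Complex.zero_le_real.2 (abs_nonneg _)) hpos
  have := Complex.nonneg_iff.1 key
  exact ⟨this.2.symm, this.1⟩

theorem integrable_rieszIntegrand (hi : Integrable (tubeNegPow f α θ))
    (σ : EuclideanSpace ℝ (Fin d)) : Integrable (rieszIntegrand f α θ σ) := by
  have hc : Continuous fun η : EuclideanSpace ℝ (Fin d) =>
      Complex.exp ((inner ℝ θ σ : ℝ) + Complex.I * (inner ℝ η σ : ℝ)) := by fun_prop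
  have hb : ∀ η : EuclideanSpace ℝ (Fin d),
      ‖Complex.exp ((inner ℝ θ σ : ℝ) + Complex.I * (inner ℝ η σ : ℝ))‖ ≤
        Real.exp (inner ℝ θ σ) := fun η => by
    rw [Complex.exp_add, norm_mul, mul_comm Complex.I, Complex.norm_exp_ofReal_mul_I, mul_one,
      Complex.norm_exp, Complex.ofReal_re]
  exact hi.mul_bdd hc.aestronglyMeasurable (Eventually.of_forall hb)

theorem rieszKernel_eq (f : MvPolynomial (Fin d) ℝ) (α : ℝ) (θ σ : EuclideanSpace ℝ (Fin d)) :
    rieszKernel f α θ σ = ((((2 * π) ^ d)⁻¹ * Real.exp (inner ℝ θ σ) : ℝ) : ℂ) *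
      ∫ η, tubeNegPow f α θ η * Complex.exp (Complex.I * (inner ℝ η σ : ℝ)) := by
  rw [rieszKernel, Complex.ofReal_mul, mul_assoc,
    ← integral_const_mul ((Real.exp (inner ℝ θ σ) : ℝ) : ℂ)]
  congr 1
  refine integral_congr_ae (Eventually.of_forall fun η => ?_)
  simp only [rieszIntegrand, Complex.exp_add, Complex.ofReal_exp]
  ring

theorem RieszKernelNonneg.isPositiveDefiniteLimit (h : IsHyperbolicAt f τ)
    (hτ : 0 < MvPolynomial.eval τ f) (hα : 0 < α) (hθ : θ ∈ hyperbolicityCone f τ)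
    (hi : Integrable (tubeNegPow f α θ)) (hR : RieszKernelNonneg f α θ) :
    IsPositiveDefiniteLimit (tubeNegPow f α θ) := by
  refine IsPositiveDefiniteLimit.of_fourier_nonneg hi (continuous_tubeNegPow h hτ hθ α)
    (norm_tubeNegPow_le h hτ hθ hα) fun s => ?_
  have h1 : 0 ≤ rieszKernel f α θ ((-2 * π) • s) :=
    Complex.nonneg_iff.2 ⟨(hR _).2, (hR _).1.symm⟩
  rw [rieszKernel_eq] at h1
  have h2 := Complex.nonneg_of_ofReal_mul (by positivity) h1
  convert h2 using 1
  rw [fourier_eq']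
  refine integral_congr_ae (Eventually.of_forall fun η => ?_)
  simp only [smul_eq_mul, real_inner_smul_right]
  rw [mul_comm, mul_comm Complex.I]

/-- Gaussian damping makes each integral nonnegative, and integrability lets the damping be removed
by dominated convergence. -/
theorem IsPositiveDefiniteLimit.rieszKernelNonneg {F : MvPolynomial (Fin c) ℝ}
    {ρ : EuclideanSpace ℝ (Fin c)} {g : EuclideanSpace ℝ (Fin d) → ℂ}
    (hg : IsPositiveDefiniteLimit g)
    (A : EuclideanSpace ℝ (Fin c) →L[ℝ] EuclideanSpace ℝ (Fin d))
    (hF : ∀ η, tubeNegPow F α ρ η = g (A η)) (hi : Integrable (tubeNegPow F α ρ)) :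
    RieszKernelNonneg F α ρ := by
  intro σ
  have hpi : (π : ℂ) ≠ 0 := by exact_mod_cast pi_ne_zero
  have hlim : Tendsto (fun n : ℕ => ∫ η, g (A η) *
      Complex.exp (-((1 / ((n : ℝ) + 1) : ℝ) : ℂ) * ‖η‖ ^ 2 +
        2 * π * Complex.I * (inner ℝ ((2 * π)⁻¹ • σ) η : ℝ))) atTop
      (𝓝 (∫ η, tubeNegPow F α ρ η * Complex.exp (Complex.I * (inner ℝ η σ : ℝ)))) := by
    simp only [← hF]
    refine tendsto_integral_of_dominated_convergence (fun η => ‖tubeNegPow F α ρ η‖)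
      (fun n => hi.1.mul (continuous_gaussian_modulated _ _).aestronglyMeasurable) hi.norm
      (fun n => Eventually.of_forall fun η => ?_) (Eventually.of_forall fun η => ?_)
    · rw [norm_mul, Complex.exp_add, norm_mul, norm_gaussian_cexp]
      have h1 : ‖Complex.exp (2 * π * Complex.I * (inner ℝ ((2 * π)⁻¹ • σ) η : ℝ))‖ = 1 := by
        rw [show (2 * π * Complex.I * (inner ℝ ((2 * π)⁻¹ • σ) η : ℝ) : ℂ) =
          ((2 * π * inner ℝ ((2 * π)⁻¹ • σ) η : ℝ) : ℂ) * Complex.I by push_cast; ring,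
          Complex.norm_exp_ofReal_mul_I]
      rw [h1, mul_one]
      refine mul_le_of_le_one_right (norm_nonneg _) (Real.exp_le_one_iff.2 ?_)
      rw [neg_mul]
      exact neg_nonpos.2 (by positivity)
    · have hc : Continuous fun a : ℝ => tubeNegPow F α ρ η * Complex.exp (-(a : ℂ) * ‖η‖ ^ 2 +
          2 * π * Complex.I * (inner ℝ ((2 * π)⁻¹ • σ) η : ℝ)) := by fun_prop
      have h2 := (hc.tendsto 0).comp (tendsto_one_div_add_atTop_nhds_zero_nat (𝕜 := ℝ))
      have h3 : tubeNegPow F α ρ η * Complex.exp (-((0 : ℝ) : ℂ) * ‖η‖ ^ 2 +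
          2 * π * Complex.I * (inner ℝ ((2 * π)⁻¹ • σ) η : ℝ)) =
          tubeNegPow F α ρ η * Complex.exp (Complex.I * (inner ℝ η σ : ℝ)) := by
        rw [real_inner_smul_left, real_inner_comm]
        congr 2
        push_cast
        field_simp
        ring
      rw [h3] at h2
      exact h2
  have h4 : 0 ≤ ∫ η, tubeNegPow F α ρ η * Complex.exp (Complex.I * (inner ℝ η σ : ℝ)) :=
    ge_of_tendsto' hlim fun n => hg.integral_comp_mul_gaussian_nonneg A (by positivity) _
  have h5 : 0 ≤ rieszKernel F α ρ σ := by
    rw [rieszKernel_eq]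
    exact mul_nonneg (Complex.zero_le_real.2 (by positivity)) h4
  have := Complex.nonneg_iff.1 h5
  exact ⟨this.2.symm, this.1⟩

end RieszKernels

/-! ### The main theorem -/

theorem mainTheorem8 {d c : ℕ} (f : MvPolynomial (Fin d) ℝ) (τ : EuclideanSpace ℝ (Fin d))
    (hf : IsHyperbolicAt f τ) (hpos : 0 < MvPolynomial.eval τ f)
    (α : ℝ) (hα : 0 < α)
    (θ : EuclideanSpace ℝ (Fin d)) (hθ : θ ∈ hyperbolicityCone f τ)
    (L : Submodule ℝ (EuclideanSpace ℝ (Fin d))) (b : Module.Basis (Fin c) ℝ L)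
    (e : L) (he : (e : EuclideanSpace ℝ (Fin d)) ∈ interior (hyperbolicityCone f τ)) :
    IsHyperbolicAt (restrictPolynomial f b) (basisCoords b e) ∧
    (RieszDistributionNonneg f α θ →
      ∀ ρ ∈ hyperbolicityCone (restrictPolynomial f b) (basisCoords b e),
        RieszDistributionNonneg (restrictPolynomial f b) α ρ) ∧
    (HasPointedCone f τ → (d : ℝ) < α → RieszKernelNonneg f α θ →
      ∀ ρ ∈ hyperbolicityCone (restrictPolynomial f b) (basisCoords b e),
        (∀ σ : EuclideanSpace ℝ (Fin c),
          Integrable (rieszIntegrand (restrictPolynomial f b) α ρ σ)) ∧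
        RieszKernelNonneg (restrictPolynomial f b) α ρ) := by
  have heC : basisMap b (basisCoords b e) ∈ hyperbolicityCone f τ := by
    rw [basisMap_basisCoords]
    exact interior_subset he
  obtain ⟨p, hhom, -, -⟩ := id hf
  -- The point e may differ from τ, so Gårding's theorem is needed already for the first claim.
  have hyp : IsHyperbolicAt (restrictPolynomial f b) (basisCoords b e) :=
    isHyperbolicAt_restrictPolynomial ((hf.stableAt_of_mem heC).isHyperbolicAt hhom)
  have hrest : ∀ ρ η, tubeNegPow (restrictPolynomial f b) α ρ η =
      tubeNegPow f α (basisMap b ρ) (basisMap b η) := tubeNegPow_restrictPolynomial f b α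
  refine ⟨hyp, fun hR ρ hρ => ?_, fun hC hαd hR ρ hρ => ?_⟩
  · have hpd := isPositiveDefiniteLimit_tubeNegPow hf hpos hα hθ
      (hR.isPositiveDefiniteLimit hf hpos hα hθ) (basisMap_mem_hyperbolicityCone heC hρ)
    exact hpd.rieszDistributionNonneg (basisMap b) (hrest ρ)
  · have hpd := isPositiveDefiniteLimit_tubeNegPow hf hpos hα hθ
      (hR.isPositiveDefiniteLimit hf hpos hα hθ (integrable_tubeNegPow hf hpos hC hθ hαd))
      (basisMap_mem_hyperbolicityCone heC hρ)
    -- Hence α > d ≥ c, and the integrability criterion applies in dimension c, pointedness being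
    -- inherited by the slice.
    have hcd : c ≤ d := by
      have h1 := LinearMap.finrank_le_finrank_of_injective
        (f := (basisMap b).toLinearMap) (basisMap_injective b)
      simpa using h1
    have hi : Integrable (tubeNegPow (restrictPolynomial f b) α ρ) :=
      integrable_tubeNegPow hyp (by
        rw [eval_restrictPolynomial]
        exact eval_pos_of_mem_hyperbolicityCone hpos heC) (hasPointedCone_restrictPolynomial hC heC) hρ
        (lt_of_le_of_lt (by exact_mod_cast hcd) hαd)
    exact ⟨fun σ => integrable_rieszIntegrand hi σ,
      hpd.rieszKernelNonneg (basisMap b) (hrest ρ) hi⟩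

end
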